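/- Fix integers $n\ge 2$ and $\ell_1,\ell_2\ge 1$. For $\ell\ge1$ let $B_\ell$ be the $sl_n$ crystal of one-row semistandard tableaux of length $\ell$ with letters in $\{1,\dots,n\}$; such a tableau is written as its entries $\alpha_1\le\dots\le\alpha_\ell$ or as $x=(x_1,\dots,x_n)\in\mathbb Z_{\ge0}^n$, $\sum_k x_k=\ell$, where $x_k$ is the number of letters $k$. Let $B_\natural$ be the $sl_n$ crystal of columns $(\alpha,\beta)$ with $1\le\alpha<\beta\le n$. For $1\le i\le n-1$: on $B_\ell$, $\tilde f_i$ replaces one $i$ by $i+1$ (and is $0$ if there is no $i$), $\varphi_i(x)=x_i$, $\varepsilon_i(x)=x_{i+1}$; on $B_\natural$, $\tilde f_i$ replaces $i$ by $i+1$ if $i$ appears and $i+1$ does not (and is $0$ otherwise), and $\varphi_i$ (resp. $\varepsilon_i$) is $1$ if $i$ appears and $i+1$ does not (resp. $i+1$ appears and $i$ does not), and $0$ otherwise. On a tensor product (the direct product as a set) $\tilde f_i(b\otimes b')=\tilde f_ib\otimes b'$ if $\varphi_i(b)>\varepsilon_i(b')$, and $b\otimes\tilde f_ib'$ otherwise.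 An isomorphism of crystals is a bijection commuting with all $\tilde f_i$ (with $0\mapsto0$). Define $R:B_\ell\otimes B_m\to B_m\otimes B_\ell$, $(x,y)\mapsto(x',y')$, by $$x'_i=y_i+P_{i+1}-P_i,\quad y'_i=x_i+P_i-P_{i+1},\quad P_i=\max_{1\le j\le n}\Big(\sum_{k=1}^{j-1}(y_{k+i-1}-x_{k+i-1})+y_{j+i-1}\Big),$$ with indices modulo $n$. Define $\iota'':B_\ell\otimes B_\natural\to B_\natural\otimes B_\ell$ on $(\alpha_1\le\dots\le\alpha_\ell)\otimes(\beta,\gamma)$ as follows, with $\alpha_{\ell+1}=\infty$; the outgoing column is * $(\alpha_i,\alpha_j)$ if $\alpha_i<\beta\le\alpha_{i+1}$ and $\alpha_j<\gamma\le\alpha_{j+1}$ with $1\le i<j\le\ell$; * $(\alpha_i,\beta)$ if $\alpha_i<\beta$ and $\gamma\le\alpha_{i+1}$ with $1\le i\le\ell$; * $(\alpha_i,\alpha_\ell)$ if $\beta\le\alpha_1$ and $\alpha_i<\gamma\le\alpha_{i+1}$ with $0\le i<\ell$, where $\alpha_0:=\beta$ in this case; * $(\alpha_\ell,\gamma)$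 if $\beta\le\alpha_1$ and $\gamma>\alpha_\ell$; and the outgoing row consists of the remaining letters of $\alpha_1,\dots,\alpha_\ell,\beta,\gamma$. Define $(\iota'')^{-1}:B_\natural\otimes B_\ell\to B_\ell\otimes B_\natural$ on $(\alpha,\beta)\otimes(\gamma_1\le\dots\le\gamma_\ell)$ as follows, with $\gamma_0=-\infty$; the outgoing column is * $(\gamma_1,\beta)$ if $\gamma_\ell\le\alpha$; * $(\gamma_1,\gamma_i)$ if $\gamma_{i-1}\le\alpha<\gamma_i$ and $\gamma_\ell\le\beta$ with $2\le i\le\ell$; * $(\alpha,\gamma_1)$ if $\alpha<\gamma_1$ and $\gamma_\ell\le\beta$; * $(\gamma_i,\gamma_j)$ if $\gamma_{i-1}\le\alpha<\gamma_i$ and $\gamma_{j-1}\le\beta<\gamma_j$ with $1\le i<j\le\ell$; * $(\beta,\gamma_i)$ if $\gamma_{i-1}\le\alpha$ and $\beta<\gamma_i$ with $1\le i\le\ell$; and the outgoing row consists of the remaining letters. Let $\sigma$ denote whichever of $R$, $\iota''$, $(\iota'')^{-1}$ applies to a given pair of factors, and put $\sigma_1(b_1\otimes b_2\otimes b_3)=\sigma(b_1\otimes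 b_2)\otimes b_3$, $\sigma_2(b_1\otimes b_2\otimes b_3)=b_1\otimes\sigma(b_2\otimes b_3)$. **Lemma.** $R:B_{\ell_1}\otimes B_{\ell_2}\to B_{\ell_2}\otimes B_{\ell_1}$ and $\iota'':B_{\ell_1}\otimes B_\natural\to B_\natural\otimes B_{\ell_1}$ are isomorphisms of $sl_n$ crystals, the map $(\iota'')^{-1}$ is the two-sided inverse of $\iota''$, and $$\sigma_1\sigma_2\sigma_1=\sigma_2\sigma_1\sigma_2$$ holds on $B_{\ell_1}\otimes B_{\ell_2}\otimes B_\natural$, as well as on $B_{\ell_1}\otimes B_\natural\otimes B_{\ell_2}$ and on $B_\natural\otimes B_{\ell_1}\otimes B_{\ell_2}$. -/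

import Mathlib

namespace ColouredBBS

/-- The data of an `sl_n` crystal used here: the maps `f_i` from `B` to `B ⊔ {0}`
(with `none` in the role of `0`) and the maps `φ_i`, `ε_i`, for the indices
`i ∈ {1, …, n-1}`, which are numbered `0, …, n-2`. -/
structure Crystal (n : ℕ) where
  carrier : Type
  f : Fin (n - 1) → carrier → Option carrier
  phi : Fin (n - 1) → carrier → ℕ
  eps : Fin (n - 1) → carrier → ℕ

/-- The tensor product of crystals: the direct product as a set, with
`f_i (b ⊗ b') = f_i b ⊗ b'` if `φ_i b > ε_i b'` and `b ⊗ f_i b'` otherwise. -/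
def Crystal.tensor {n : ℕ} (B C : Crystal n) : Crystal n where
  carrier := B.carrier × C.carrier
  f i b :=
    if C.eps i b.2 < B.phi i b.1 then (B.f i b.1).map (fun c => (c, b.2))
    else (C.f i b.2).map (fun c => (b.1, c))
  phi i b := max (C.phi i b.2) (B.phi i b.1 + C.phi i b.2 - C.eps i b.2)
  eps i b := max (B.eps i b.1) (B.eps i b.1 + C.eps i b.2 - B.phi i b.1)

/-- An isomorphism of crystals: a bijection commuting with all `f_i` (and with `0 ↦ 0`). -/
def IsCrystalIso {n : ℕ} (B C : Crystal n) (g : B.carrier → C.carrier) : Prop :=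
  Function.Bijective g ∧ ∀ i b, C.f i (g b) = (B.f i b).map g

/-- The letter `i`, for a crystal index `i`. The letters `1, …, n` are numbered `0, …, n-1`. -/
def lo {n : ℕ} (i : Fin (n - 1)) : Fin n := ⟨i.1, by have := i.2; omega⟩

/-- The letter `i + 1`, for a crystal index `i`. -/
def hi {n : ℕ} (i : Fin (n - 1)) : Fin n := ⟨i.1 + 1, by have := i.2; omega⟩

/-- The elements of `B_ℓ`: one-row semistandard tableaux of length `ℓ`, given by the
number `x k` of times that each letter `k` appears. -/
abbrev Row (n ℓ : ℕ) : Type := {x : Fin n → ℕ // ∑ k, x k = ℓ}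

/-- The elements of `B_♮`: columns with entries `α < β` (`α` on top). -/
abbrev Domino (n : ℕ) : Type := {d : Fin n × Fin n // d.1 < d.2}

theorem sum_exchange {n : ℕ} (x a b : Fin n → ℕ) (hab : ∑ k, a k = ∑ k, b k)
    (h : ∀ k, b k ≤ x k + a k) : ∑ k, (x k + a k - b k) = ∑ k, x k := by
  have h1 : ∑ k, (x k + a k - b k) + ∑ k, b k = ∑ k, (x k + a k) := by
    rw [← Finset.sum_add_distrib]
    exact Finset.sum_congr rfl fun k _ => Nat.sub_add_cancel (h k)
  rw [Finset.sum_add_distrib] at h1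
  omega

/-- `f_i` on `B_ℓ`: replace one letter `i` by `i + 1` if there is an `i`; otherwise `0`. -/
def rowF {n ℓ : ℕ} (i : Fin (n - 1)) (x : Row n ℓ) : Option (Row n ℓ) :=
  if h : 0 < x.1 (lo i) then
    some ⟨fun k => x.1 k + (if k = hi i then 1 else 0) - (if k = lo i then 1 else 0), by
      rw [sum_exchange, x.2]
      · simp
      · intro k
        by_cases hk : k = lo i
        · subst hk; simp only [if_true]; omega
        · simp [hk]⟩
  else none

/-- The crystal `B_ℓ`. -/
def rowCrystal (n ℓ : ℕ) : Crystal n where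
  carrier := Row n ℓ
  f := rowF
  phi i x := x.1 (lo i)
  eps i x := x.1 (hi i)

/-- The letter `k` appears in the column `d`. -/
def Domino.Has {n : ℕ} (d : Domino n) (k : Fin n) : Prop := k = d.1.1 ∨ k = d.1.2

instance {n : ℕ} (d : Domino n) (k : Fin n) : Decidable (d.Has k) :=
  inferInstanceAs (Decidable (_ ∨ _))

/-- `f_i` on `B_♮`: replace `i` by `i + 1` if `i` appears and `i + 1` does not; otherwise `0`. -/
def dominoF {n : ℕ} (i : Fin (n - 1)) (d : Domino n) : Option (Domino n) :=
  if h : d.Has (lo i) ∧ ¬ d.Has (hi i) then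
    some ⟨(if d.1.1 = lo i then hi i else d.1.1, if d.1.2 = lo i then hi i else d.1.2), by
      obtain ⟨⟨a, b⟩, hab⟩ := d
      simp only [Domino.Has, lo, hi, Fin.ext_iff, Fin.lt_def] at h hab ⊢
      split_ifs <;> simp_all <;> omega⟩
  else none

/-- The crystal `B_♮`. -/
def dominoCrystal (n : ℕ) : Crystal n where
  carrier := Domino n
  f := dominoF
  phi i d := if d.Has (lo i) ∧ ¬ d.Has (hi i) then 1 else 0
  eps i d := if d.Has (hi i) ∧ ¬ d.Has (lo i) then 1 else 0

/-! ### The piecewise linear map `R` -/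

/-- The `j`-th expression in the maximum that defines `P_i` (with `j` starting at `0`):
`∑_{k<j} (y_{i+k} - x_{i+k}) + y_{i+j}`, indices modulo `n`. -/
def term {n : ℕ} [NeZero n] (x y : Fin n → ℕ) (i : Fin n) (j : ℕ) : ℤ :=
  ∑ k ∈ Finset.range j, ((y (i + Fin.ofNat n k) : ℤ) - x (i + Fin.ofNat n k))
    + y (i + Fin.ofNat n j)

/-- `P_i = max_{0 ≤ j < n} (∑_{k<j} (y_{i+k} - x_{i+k}) + y_{i+j})`, indices modulo `n`. -/
def P {n : ℕ} [NeZero n] (x y : Fin n → ℕ) (i : Fin n) : ℤ :=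
  (Finset.range n).sup' (Finset.nonempty_range_iff.2 (NeZero.ne n)) (term x y i)

theorem term_le_P {n : ℕ} [NeZero n] (x y : Fin n → ℕ) (i : Fin n) {j : ℕ} (hj : j < n) :
    term x y i j ≤ P x y i :=
  Finset.le_sup' (term x y i) (Finset.mem_range.2 hj)

theorem term_zero {n : ℕ} [NeZero n] (x y : Fin n → ℕ) (i : Fin n) : term x y i 0 = y i := by
  simp [term]

theorem ofNat_succ_aux {n : ℕ} [NeZero n] (i : Fin n) (k : ℕ) :
    i + Fin.ofNat n (k + 1) = i + 1 + Fin.ofNat n k := by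
  apply Fin.ext
  simp [Fin.val_add, Fin.coe_ofNat_eq_mod]
  congr 1
  omega

theorem term_succ {n : ℕ} [NeZero n] (x y : Fin n → ℕ) (i : Fin n) (j : ℕ) :
    term x y i (j + 1) = (y i : ℤ) - x i + term x y (i + 1) j := by
  unfold term
  rw [Finset.sum_range_succ', ofNat_succ_aux]
  simp only [ofNat_succ_aux]
  simp
  ring

theorem sum_cyclic {n : ℕ} [NeZero n] (g : Fin n → ℤ) (i : Fin n) :
    ∑ k ∈ Finset.range n, g (i + Fin.ofNat n k) = ∑ k, g k := by
  rw [← Fin.sum_univ_eq_sum_range (fun k => g (i + Fin.ofNat n k)) n]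
  have : ∀ k : Fin n, Fin.ofNat n k.1 = k := fun k => by
    apply Fin.ext; simp
  simp only [this]
  exact Fintype.sum_equiv (Equiv.addLeft i) _ _ (fun _ => rfl)

theorem term_last {n : ℕ} [NeZero n] (x y : Fin n → ℕ) (i : Fin n) :
    ∑ k, ((y k : ℤ) - x k) ≤ term x y i (n - 1) := by
  have hn : n - 1 + 1 = n := Nat.sub_add_cancel (Nat.pos_of_ne_zero (NeZero.ne n))
  have h := sum_cyclic (fun k => (y k : ℤ) - x k) i
  have hr : Finset.range n = Finset.range (n - 1 + 1) := by rw [hn]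
  rw [← h, hr, Finset.sum_range_succ]
  unfold term
  have : (0 : ℤ) ≤ x (i + Fin.ofNat n (n - 1)) := Int.natCast_nonneg _
  linarith

theorem R_fst_nonneg {n : ℕ} [NeZero n] (x y : Fin n → ℕ) (i : Fin n) :
    0 ≤ (y i : ℤ) + P x y (i + 1) - P x y i := by
  have hn : 0 < n := Nat.pos_of_ne_zero (NeZero.ne n)
  have h0 : (0 : ℤ) ≤ P x y (i + 1) := by
    have := term_le_P x y (i + 1) hn
    rw [term_zero] at this
    omega
  have : P x y i ≤ y i + P x y (i + 1) := by
    refine Finset.sup'_le _ _ fun j hj => ?_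
    rw [Finset.mem_range] at hj
    cases j with
    | zero => rw [term_zero]; omega
    | succ j =>
      rw [term_succ]
      have := term_le_P x y (i + 1) (j := j) (by omega)
      omega
  omega

theorem R_snd_nonneg {n : ℕ} [NeZero n] (x y : Fin n → ℕ) (i : Fin n) :
    0 ≤ (x i : ℤ) + P x y i - P x y (i + 1) := by
  have hn : 0 < n := Nat.pos_of_ne_zero (NeZero.ne n)
  have : P x y (i + 1) ≤ x i + P x y i := by
    refine Finset.sup'_le _ _ fun j hj => ?_
    rw [Finset.mem_range] at hj
    by_cases hj' : j + 1 < n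
    · have h1 := term_le_P x y i hj'
      rw [term_succ] at h1
      omega
    · have hjn : j + 1 = n := by omega
      have h1 := term_succ x y i j
      have h2 := term_le_P x y i (j := n - 1) (by omega)
      have h3 := term_last x y i
      have h4 : term x y i (j + 1) = ∑ k, ((y k : ℤ) - x k) + y i := by
        rw [hjn, ← sum_cyclic (fun k => (y k : ℤ) - x k) i]
        unfold term
        congr 3
        apply Fin.ext
        simp
      omega
  omega

theorem sum_shift {n : ℕ} [NeZero n] (p : Fin n → ℤ) : ∑ i, p (i + 1) = ∑ i, p i :=
  Fintype.sum_equiv (Equiv.addRight 1) _ _ (fun _ => rfl)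

/-- The map `R : B_ℓ ⊗ B_m → B_m ⊗ B_ℓ`, `(x, y) ↦ (x', y')` with
`x'_i = y_i + P_{i+1} - P_i` and `y'_i = x_i + P_i - P_{i+1}`, indices modulo `n`.
(The values are nonnegative, so that `Int.toNat` only changes the type.) -/
def R (n ℓ m : ℕ) [NeZero n] (b : Row n ℓ × Row n m) : Row n m × Row n ℓ :=
  (⟨fun i => ((b.2.1 i : ℤ) + P b.1.1 b.2.1 (i + 1) - P b.1.1 b.2.1 i).toNat, by
      zify
      simp only [Int.toNat_of_nonneg (R_fst_nonneg b.1.1 b.2.1 _), Finset.sum_sub_distrib,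
        Finset.sum_add_distrib, sum_shift]
      rw [add_sub_cancel_right]
      exact_mod_cast b.2.2⟩,
   ⟨fun i => ((b.1.1 i : ℤ) + P b.1.1 b.2.1 i - P b.1.1 b.2.1 (i + 1)).toNat, by
      zify
      simp only [Int.toNat_of_nonneg (R_snd_nonneg b.1.1 b.2.1 _), Finset.sum_sub_distrib,
        Finset.sum_add_distrib, sum_shift]
      rw [add_sub_cancel_right]
      exact_mod_cast b.1.2⟩)

/-! ### The map `ι''` and its inverse

In both maps the letters of the tensor product as a whole are preserved, so that the outgoing
row is determined by the outgoing column. -/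

/-- The letters of a row. -/
def letters {n : ℕ} (x : Fin n → ℕ) : Finset (Fin n) := Finset.univ.filter (fun k => 0 < x k)

/-- The letters of a row that are smaller than `b`. -/
def below {n : ℕ} (x : Fin n → ℕ) (b : Fin n) : Finset (Fin n) :=
  Finset.univ.filter (fun k => 0 < x k ∧ k < b)

/-- The letters of a row that are larger than `b`. -/
def above {n : ℕ} (x : Fin n → ℕ) (b : Fin n) : Finset (Fin n) :=
  Finset.univ.filter (fun k => 0 < x k ∧ b < k)

/-- The column obtained by `ι''` from the row with the letters `α_1 ≤ … ≤ α_ℓ` and the column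
`β < γ`. The letter `α_i` with `α_i < β ≤ α_{i+1}` is the largest letter of the row below `β`,
and likewise for `γ`. The cases are, in this order:
`(α_i, α_j)` if `α_i < β ≤ α_{i+1}` and `α_j < γ ≤ α_{j+1}` with `i ≠ j`;
`(α_i, β)` if `α_i < β` and `γ ≤ α_{i+1}`;
`(α_i, α_ℓ)` if `β ≤ α_1` and `α_i < γ ≤ α_{i+1}` with `i < ℓ`, where `α_0 = β`
(so `(β, α_ℓ)` if `γ ≤ α_1`);
`(α_ℓ, γ)` if `β ≤ α_1` and `γ > α_ℓ`.
Here `α_{ℓ+1} = ∞`. (The last value is for the empty row.) -/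
def iotaColumn {n : ℕ} (x : Fin n → ℕ) (β γ : Fin n) : Fin n × Fin n :=
  if hβ : (below x β).Nonempty then
    if hγ : (below x γ).Nonempty then
      if (below x β).max' hβ < (below x γ).max' hγ then
        ((below x β).max' hβ, (below x γ).max' hγ)
      else ((below x β).max' hβ, β)
    else (β, γ) -- impossible for `β < γ`
  else
    if hx : (letters x).Nonempty then
      if γ ≤ (letters x).max' hx then
        if hγ : (below x γ).Nonempty then ((below x γ).max' hγ, (letters x).max' hx)
        else (β, (letters x).max' hx)
      else ((letters x).max' hx, γ)
    else (β, γ)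

/-- The column obtained by `(ι'')⁻¹` from the column `α < β` and the row with the letters
`γ_1 ≤ … ≤ γ_ℓ`. The letter `γ_i` with `γ_{i-1} ≤ α < γ_i` is the smallest letter of the row
above `α`, and likewise for `β`. The cases are, in this order:
`(γ_i, γ_j)` if `γ_{i-1} ≤ α < γ_i` and `γ_{j-1} ≤ β < γ_j` with `i ≠ j`;
`(β, γ_i)` if `γ_{i-1} ≤ α` and `β < γ_i`;
`(γ_1, γ_i)` if `γ_{i-1} ≤ α < γ_i` with `i > 1` and `γ_ℓ ≤ β`;
`(α, γ_1)` if `α < γ_1` and `γ_ℓ ≤ β`;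
`(γ_1, β)` if `γ_ℓ ≤ α`.
Here `γ_0 = -∞`. (The last value is for the empty row.) -/
def iotaInvColumn {n : ℕ} (x : Fin n → ℕ) (α β : Fin n) : Fin n × Fin n :=
  if hx : (letters x).Nonempty then
    if hα : (above x α).Nonempty then
      if hβ : (above x β).Nonempty then
        if (above x α).min' hα < (above x β).min' hβ then
          ((above x α).min' hα, (above x β).min' hβ)
        else (β, (above x α).min' hα)
      else
        if (letters x).min' hx ≤ α then ((letters x).min' hx, (above x α).min' hα)
        else (α, (letters x).min' hx)
    else ((letters x).min' hx, β)
  else (α, β)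

/-- `d'` is a column whose letters occur in the row `x` or the column `d`. -/
def IsExchange {n : ℕ} (x : Fin n → ℕ) (d d' : Fin n × Fin n) : Prop :=
  d'.1 < d'.2 ∧ (0 < x d'.1 ∨ d'.1 = d.1 ∨ d'.1 = d.2) ∧ (0 < x d'.2 ∨ d'.2 = d.1 ∨ d'.2 = d.2)

theorem iotaColumn_isExchange {n : ℕ} (x : Fin n → ℕ) (β γ : Fin n) (h : β < γ) :
    IsExchange x (β, γ) (iotaColumn x β γ) := by
  have mb : ∀ c (hc : (below x c).Nonempty),
      0 < x ((below x c).max' hc) ∧ (below x c).max' hc < c := fun c hc => by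
    simpa [below] using (below x c).max'_mem hc
  have ml : ∀ (hc : (letters x).Nonempty), 0 < x ((letters x).max' hc) := fun hc => by
    simpa [letters] using (letters x).max'_mem hc
  unfold iotaColumn IsExchange
  split_ifs with h1 h2 h3 h4 h5 h6
  · exact ⟨h3, .inl (mb _ h1).1, .inl (mb _ h2).1⟩
  · exact ⟨(mb _ h1).2, .inl (mb _ h1).1, .inr (.inl rfl)⟩
  · exact ⟨h, .inr (.inl rfl), .inr (.inr rfl)⟩
  · exact ⟨lt_of_lt_of_le (mb _ h6).2 h5, .inl (mb _ h6).1, .inl (ml h4)⟩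
  · exact ⟨lt_of_lt_of_le h h5, .inr (.inl rfl), .inl (ml h4)⟩
  · exact ⟨not_le.1 h5, .inl (ml h4), .inr (.inr rfl)⟩
  · exact ⟨h, .inr (.inl rfl), .inr (.inr rfl)⟩

theorem iotaInvColumn_isExchange {n : ℕ} (x : Fin n → ℕ) (α β : Fin n) (h : α < β) :
    IsExchange x (α, β) (iotaInvColumn x α β) := by
  have ma : ∀ c (hc : (above x c).Nonempty),
      0 < x ((above x c).min' hc) ∧ c < (above x c).min' hc := fun c hc => by
    simpa [above] using (above x c).min'_mem hc
  have ml : ∀ (hc : (letters x).Nonempty), 0 < x ((letters x).min' hc) := fun hc => by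
    simpa [letters] using (letters x).min'_mem hc
  unfold iotaInvColumn IsExchange
  split_ifs with h1 h2 h3 h4 h5
  · exact ⟨h4, .inl (ma _ h2).1, .inl (ma _ h3).1⟩
  · refine ⟨lt_of_lt_of_le (ma _ h3).2 (not_lt.1 h4), .inr (.inr rfl), .inl (ma _ h2).1⟩
  · exact ⟨lt_of_le_of_lt h5 (ma _ h2).2, .inl (ml h1), .inl (ma _ h2).1⟩
  · exact ⟨not_le.1 h5, .inr (.inl rfl), .inl (ml h1)⟩
  · refine ⟨?_, .inl (ml h1), .inr (.inr rfl)⟩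
    refine lt_of_le_of_lt (not_lt.1 fun hc => h2 ?_) h
    exact ⟨_, by simpa [above] using ⟨ml h1, hc⟩⟩
  · exact ⟨h, .inr (.inl rfl), .inr (.inr rfl)⟩

/-- The number of times that the letter `k` appears in a column `d`. -/
def colCount {n : ℕ} (d : Fin n × Fin n) (k : Fin n) : ℕ :=
  (if k = d.1 then 1 else 0) + (if k = d.2 then 1 else 0)

/-- The row obtained from `x` by adding the letters of `d` and taking away those of `d'`. -/
def exchangeRow {n ℓ : ℕ} (x : Row n ℓ) (d d' : Fin n × Fin n) (h : IsExchange x.1 d d') :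
    Row n ℓ :=
  ⟨fun k => x.1 k + colCount d k - colCount d' k, by
    rw [sum_exchange, x.2]
    · simp [colCount, Finset.sum_add_distrib]
    · intro k
      obtain ⟨h1, h2, h3⟩ := h
      unfold colCount
      by_cases e1 : k = d'.1
      · have e2 : ¬ k = d'.2 := fun e => absurd (e1.symm.trans e) h1.ne
        rw [if_pos e1, if_neg e2]
        rw [← e1] at h2
        rcases h2 with h2 | h2 | h2
        · omega
        · rw [if_pos h2]; omega
        · rw [if_pos h2]; omega
      · by_cases e2 : k = d'.2
        · rw [if_neg e1, if_pos e2]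
          rw [← e2] at h3
          rcases h3 with h3 | h3 | h3
          · omega
          · rw [if_pos h3]; omega
          · rw [if_pos h3]; omega
        · rw [if_neg e1, if_neg e2]; omega⟩

/-- The map `ι'' : B_ℓ ⊗ B_♮ → B_♮ ⊗ B_ℓ`. -/
def iota (n ℓ : ℕ) (b : Row n ℓ × Domino n) : Domino n × Row n ℓ :=
  (⟨iotaColumn b.1.1 b.2.1.1 b.2.1.2, (iotaColumn_isExchange _ _ _ b.2.2).1⟩,
   exchangeRow b.1 b.2.1 _ (iotaColumn_isExchange _ _ _ b.2.2))

/-- The map `(ι'')⁻¹ : B_♮ ⊗ B_ℓ → B_ℓ ⊗ B_♮`. -/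
def iotaInv (n ℓ : ℕ) (b : Domino n × Row n ℓ) : Row n ℓ × Domino n :=
  (exchangeRow b.2 b.1.1 _ (iotaInvColumn_isExchange _ _ _ b.1.2),
   ⟨iotaInvColumn b.2.1 b.1.1.1 b.1.1.2, (iotaInvColumn_isExchange _ _ _ b.1.2).1⟩)

/-! ### The operators `σ_1`, `σ_2` on threefold tensor products -/

/-- The shapes `(ℓ)` and `(1,1)`. -/
inductive Shape where
  | row (ℓ : ℕ)
  | col

/-- The crystal `B_λ` for the shapes `(ℓ)` and `(1,1)`. -/
def Shape.crystal (n : ℕ) : Shape → Crystal n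
  | .row ℓ => rowCrystal n ℓ
  | .col => dominoCrystal n

/-- The map `σ` on a tensor product of two of these crystals: one of `R`, `ι''`, `(ι'')⁻¹`
(and the identity on `B_♮ ⊗ B_♮`). -/
def sigma (n : ℕ) [NeZero n] : (s t : Shape) →
    ((s.crystal n).tensor (t.crystal n)).carrier → ((t.crystal n).tensor (s.crystal n)).carrier
  | .row ℓ, .row m => R n ℓ m
  | .row ℓ, .col => iota n ℓ
  | .col, .row ℓ => iotaInv n ℓ
  | .col, .col => id

/-- `B_s ⊗ B_t ⊗ B_u` as a set. -/
abbrev Triple (n : ℕ) (s t u : Shape) : Type :=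
  ((s.crystal n).tensor ((t.crystal n).tensor (u.crystal n))).carrier

/-- `σ_1 (b_1 ⊗ b_2 ⊗ b_3) = σ (b_1 ⊗ b_2) ⊗ b_3`. -/
def sigma₁ {n : ℕ} [NeZero n] {s t u : Shape} (b : Triple n s t u) : Triple n t s u :=
  ((sigma n s t (b.1, b.2.1)).1, (sigma n s t (b.1, b.2.1)).2, b.2.2)

/-- `σ_2 (b_1 ⊗ b_2 ⊗ b_3) = b_1 ⊗ σ (b_2 ⊗ b_3)`. -/
def sigma₂ {n : ℕ} [NeZero n] {s t u : Shape} (b : Triple n s t u) : Triple n s u t :=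
  (b.1, sigma n t u b.2)

/-- The identity `σ_1 σ_2 σ_1 = σ_2 σ_1 σ_2` of maps on `B_s ⊗ B_t ⊗ B_u`. -/
def BraidRelation (n : ℕ) [NeZero n] (s t u : Shape) : Prop :=
  ∀ b : Triple n s t u, sigma₁ (sigma₂ (sigma₁ b)) = sigma₂ (sigma₁ (sigma₂ b))

end ColouredBBS

/-!
Both `R` and `ι''` are transports of letters by a carrier that moves around the cycle of the
letters `1, …, n`. The load of the carrier is the solution of a local recursion (a maximum over
the previous load and the letters found), and the same load, read in the opposite direction,
describes the inverse map. Turning a letter `i` into `i + 1` changes the load at one letter only,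
so that both maps commute with `f_i`, `φ_i` and `ε_i`.

Both sides of the braid relation are therefore morphisms of crystals, and it suffices to compare
them on highest weight elements of `B_{ℓ₁} ⊗ B_{ℓ₂} ⊗ B_♮`. Such an element is determined by its
content and its column, which is `(1, 2)`, `(1, 3)`, `(2, 3)` or `(3, 4)`; only the columns
`(1, 3)` and `(2, 3)` occur with the same content. Hence a bijective morphism that preserves the
content fixes all of them, except that it may exchange two with these columns, and a direct
computation for the column `(2, 3)` excludes this. As `σ` is an involution, the other two braid
relations follow.
-/

namespace ColouredBBS

section Crystals

variable {n : ℕ}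

theorem lo_ne_hi (i : Fin (n - 1)) : lo i ≠ hi i := by
  simp [lo, hi, Fin.ext_iff]

/-- The letter counts `x'` arise from `x` by turning `s` letters `i` into `i + 1`
(`-s` letters `i + 1` into `i`, if `s` is negative). -/
structure IsShift (i : Fin (n - 1)) (s : ℤ) (x x' : Fin n → ℕ) : Prop where
  apply_lo : (x' (lo i) : ℤ) = x (lo i) - s
  apply_hi : (x' (hi i) : ℤ) = x (hi i) + s
  apply_of_ne : ∀ k, k ≠ lo i → k ≠ hi i → x' k = x k

theorem isShift_zero_iff {i : Fin (n - 1)} {x x' : Fin n → ℕ} : IsShift i 0 x x' ↔ x = x' := by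
  refine ⟨fun h => funext fun k => ?_, ?_⟩
  · by_cases hlo : k = lo i
    · subst hlo; exact_mod_cast (by simpa using h.apply_lo.symm)
    by_cases hhi : k = hi i
    · subst hhi; exact_mod_cast (by simpa using h.apply_hi.symm)
    exact (h.apply_of_ne k hlo hhi).symm
  · rintro rfl
    exact ⟨by simp, by simp, fun _ _ _ => rfl⟩

theorem IsShift.right_unique {i : Fin (n - 1)} {s : ℤ} {x y z : Fin n → ℕ} (hy : IsShift i s x y)
    (hz : IsShift i s x z) : y = z :=
  isShift_zero_iff.1
    ⟨by linarith [hy.apply_lo, hz.apply_lo], by linarith [hy.apply_hi, hz.apply_hi], fun k h₁ h₂ =>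
      (hz.apply_of_ne k h₁ h₂).trans (hy.apply_of_ne k h₁ h₂).symm⟩

theorem IsShift.add {i : Fin (n - 1)} {s t : ℤ} {x x' y y' : Fin n → ℕ} (hx : IsShift i s x x')
    (hy : IsShift i t y y') : IsShift i (s + t) (fun k => x k + y k) (fun k => x' k + y' k) where
  apply_lo := by push_cast; linarith [hx.apply_lo, hy.apply_lo]
  apply_hi := by push_cast; linarith [hx.apply_hi, hy.apply_hi]
  apply_of_ne k h₁ h₂ := congrArg₂ (· + ·) (hx.apply_of_ne k h₁ h₂) (hy.apply_of_ne k h₁ h₂)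

theorem IsShift.sum_mul {i : Fin (n - 1)} {s : ℤ} {x x' : Fin n → ℕ} (h : IsShift i s x x')
    (g : Fin n → ℤ) : ∑ k, g k * x' k = ∑ k, g k * x k + s * (g (hi i) - g (lo i)) := by
  have apply (k : Fin n) :
      (x' k : ℤ) = x k + ((if k = hi i then s else 0) - (if k = lo i then s else 0)) := by
    by_cases hlo : k = lo i
    · subst hlo; rw [if_neg (lo_ne_hi i), if_pos rfl, h.apply_lo]; ring
    by_cases hhi : k = hi i
    · subst hhi; rw [if_pos rfl, if_neg hlo, h.apply_hi]; ring
    rw [if_neg hlo, if_neg hhi, h.apply_of_ne k hlo hhi]; ring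
  simp only [apply, mul_add, mul_sub, mul_ite, mul_zero, Finset.sum_add_distrib,
    Finset.sum_sub_distrib, Finset.sum_ite_eq', Finset.mem_univ, if_true]
  ring

/-- `φ_i` measures the `i`-strings of `B` from the end and `ε_i` from the beginning, where `w b k`
is the number of letters `k` in `b`: `f_i` turns a letter `i` into `i + 1`, and `φ_i - ε_i` is the
number of letters `i` minus the number of letters `i + 1`. -/
structure Crystal.IsNormal (B : Crystal n) (w : B.carrier → Fin n → ℕ) : Prop where
  phi_of_none : ∀ {i b}, B.f i b = none → B.phi i b = 0
  phi_of_some : ∀ {i b c}, B.f i b = some c → B.phi i b = B.phi i c + 1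
  exists_f : ∀ {i c}, 0 < B.eps i c → ∃ b, B.f i b = some c
  isShift : ∀ {i b c}, B.f i b = some c → IsShift i 1 (w b) (w c)
  phi_add : ∀ i b, B.phi i b + w b (hi i) = B.eps i b + w b (lo i)

theorem Crystal.IsNormal.eps_of_some {B : Crystal n} {w : B.carrier → Fin n → ℕ}
    (hB : B.IsNormal w) {i : Fin (n - 1)} {b c : B.carrier} (h : B.f i b = some c) :
    B.eps i c = B.eps i b + 1 := by
  have hφ := hB.phi_of_some h
  have hs := hB.isShift h
  have hlo := hs.apply_lo
  have hhi := hs.apply_hi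
  have hb := hB.phi_add i b
  have hc := hB.phi_add i c
  omega

/-- The elements of `B` are determined by their letter counts `w`, and `f_i` turns a letter `i`
into `i + 1` whenever the result is an element of `B`. -/
structure Crystal.IsContentDetermined (B : Crystal n) (w : B.carrier → Fin n → ℕ) : Prop where
  injective : Function.Injective w
  f_eq_some_iff : ∀ {i b c}, B.f i b = some c ↔ IsShift i 1 (w b) (w c)

theorem Crystal.IsContentDetermined.of_isShift {B : Crystal n} {w : B.carrier → Fin n → ℕ}
    (injective : Function.Injective w)
    (isShift : ∀ {i b c}, B.f i b = some c → IsShift i 1 (w b) (w c))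
    (ne_none : ∀ {i b c}, IsShift i 1 (w b) (w c) → B.f i b ≠ none) :
    B.IsContentDetermined w where
  injective := injective
  f_eq_some_iff {i b c} := by
    refine ⟨isShift, fun h => ?_⟩
    obtain ⟨c', hc'⟩ := Option.ne_none_iff_exists'.1 (ne_none h)
    rw [hc', injective ((isShift hc').right_unique h)]

/-- The rule by which `f_i` acts on a tensor product `b ⊗ c` with `φ = φ_i(b)` and `ε = ε_i(c)`:
it is applied `u` times to `b` and `v` times to `c`. -/
def SignatureRule (u v φ ε : ℤ) : Prop := u = 1 ∧ v = 0 ∧ ε < φ ∨ u = 0 ∧ v = 1 ∧ φ ≤ ε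

theorem Crystal.tensor_f_eq_some_iff {B C : Crystal n} {i : Fin (n - 1)} {b b' : B.carrier}
    {c c' : C.carrier} : (B.tensor C).f i (b, c) = some (b', c') ↔
      C.eps i c < B.phi i b ∧ B.f i b = some b' ∧ c = c' ∨
        B.phi i b ≤ C.eps i c ∧ b = b' ∧ C.f i c = some c' := by
  by_cases h : C.eps i c < B.phi i b
  · simp [Crystal.tensor, h]
  · simp [Crystal.tensor, h, not_lt.1 h, and_comm]

theorem Crystal.IsContentDetermined.tensor_f_eq_some_iff {B C : Crystal n}
    {w : B.carrier → Fin n → ℕ} {v : C.carrier → Fin n → ℕ} (hB : B.IsContentDetermined w)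
    (hC : C.IsContentDetermined v) {i : Fin (n - 1)} {b b' : B.carrier} {c c' : C.carrier} :
    (B.tensor C).f i (b, c) = some (b', c') ↔ ∃ s t, IsShift i s (w b) (w b') ∧
      IsShift i t (v c) (v c') ∧ SignatureRule s t (B.phi i b) (C.eps i c) := by
  rw [Crystal.tensor_f_eq_some_iff, hB.f_eq_some_iff, hC.f_eq_some_iff, ← hB.injective.eq_iff,
    ← hC.injective.eq_iff, ← isShift_zero_iff (i := i), ← isShift_zero_iff (i := i)]
  constructor
  · rintro (⟨h, hb, hc⟩ | ⟨h, hb, hc⟩)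
    · exact ⟨1, 0, hb, hc, .inl ⟨rfl, rfl, mod_cast h⟩⟩
    · exact ⟨0, 1, hb, hc, .inr ⟨rfl, rfl, mod_cast h⟩⟩
  · rintro ⟨s, t, hb, hc, ⟨rfl, rfl, h⟩ | ⟨rfl, rfl, h⟩⟩
    · exact .inl ⟨mod_cast h, hb, hc⟩
    · exact .inr ⟨mod_cast h, hb, hc⟩

theorem Crystal.tensor_phi (B C : Crystal n) (i : Fin (n - 1)) (b : B.carrier) (c : C.carrier) :
    (B.tensor C).phi i (b, c) = max (C.phi i c) (B.phi i b + C.phi i c - C.eps i c) :=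
  rfl

theorem Crystal.tensor_eps (B C : Crystal n) (i : Fin (n - 1)) (b : B.carrier) (c : C.carrier) :
    (B.tensor C).eps i (b, c) = max (B.eps i b) (B.eps i b + C.eps i c - B.phi i b) :=
  rfl

theorem Crystal.IsNormal.tensor {B C : Crystal n} {w : B.carrier → Fin n → ℕ}
    {v : C.carrier → Fin n → ℕ} (hB : B.IsNormal w) (hC : C.IsNormal v) :
    (B.tensor C).IsNormal (fun b k => w b.1 k + v b.2 k) where
  phi_of_none := by
    rintro i ⟨b, c⟩ h
    rw [Crystal.tensor_phi]
    by_cases hlt : C.eps i c < B.phi i b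
    · simp only [Crystal.tensor, hlt, if_true, Option.map_eq_none_iff] at h
      have := hB.phi_of_none h
      omega
    · simp only [Crystal.tensor, hlt, if_false, Option.map_eq_none_iff] at h
      have := hC.phi_of_none h
      omega
  phi_of_some := by
    rintro i ⟨b, c⟩ ⟨b', c'⟩ h
    simp only [Crystal.tensor_phi]
    rcases Crystal.tensor_f_eq_some_iff.1 h with ⟨_, hb, rfl⟩ | ⟨_, rfl, hc⟩
    · have := hB.phi_of_some hb
      omega
    · have := hC.phi_of_some hc
      have := hC.eps_of_some hc
      omega
  exists_f := by
    rintro i ⟨b, c⟩ h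
    rw [Crystal.tensor_eps] at h
    by_cases hle : C.eps i c ≤ B.phi i b
    · obtain ⟨b', hb⟩ := hB.exists_f (i := i) (c := b) (by omega)
      have := hB.phi_of_some hb
      exact ⟨(b', c), Crystal.tensor_f_eq_some_iff.2 (.inl ⟨by omega, hb, rfl⟩)⟩
    · obtain ⟨c', hc⟩ := hC.exists_f (i := i) (c := c) (by omega)
      have := hC.eps_of_some hc
      exact ⟨(b, c'), Crystal.tensor_f_eq_some_iff.2 (.inr ⟨by omega, rfl, hc⟩)⟩
  isShift := by
    rintro i ⟨b, c⟩ ⟨b', c'⟩ h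
    rcases Crystal.tensor_f_eq_some_iff.1 h with ⟨_, hb, rfl⟩ | ⟨_, rfl, hc⟩
    · exact (hB.isShift hb).add (isShift_zero_iff.2 rfl)
    · exact (isShift_zero_iff.2 rfl).add (hC.isShift hc)
  phi_add := by
    rintro i ⟨b, c⟩
    have hb := hB.phi_add i b
    have hc := hC.phi_add i c
    simp only [Crystal.tensor_phi, Crystal.tensor_eps]
    omega

/-- Strict morphisms of crystals: maps that preserve `f_i`, `φ_i` and `ε_i`. -/
structure IsMorphism (B C : Crystal n) (g : B.carrier → C.carrier) : Prop where
  f : ∀ i b, C.f i (g b) = (B.f i b).map g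
  phi : ∀ i b, C.phi i (g b) = B.phi i b
  eps : ∀ i b, C.eps i (g b) = B.eps i b

theorem Crystal.IsNormal.isMorphism {B C : Crystal n} {w : B.carrier → Fin n → ℕ}
    {v : C.carrier → Fin n → ℕ} (hB : B.IsNormal w) (hC : C.IsNormal v)
    {g : B.carrier → C.carrier} (hw : ∀ b, v (g b) = w b)
    (hφ : ∀ i b, C.phi i (g b) = B.phi i b)
    (hf : ∀ i b b', B.f i b = some b' → C.f i (g b) = some (g b')) : IsMorphism B C g where
  f i b := by
    cases hb : B.f i b with
    | some b' => exact hf i b b' hb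
    | none =>
      cases hc : C.f i (g b) with
      | none => rfl
      | some c =>
        have := hB.phi_of_none hb
        have := hC.phi_of_some hc
        have := hφ i b
        omega
  phi := hφ
  eps i b := by
    have hb := hB.phi_add i b
    have hc := hC.phi_add i (g b)
    rw [hw, hφ] at hc
    omega

section Morphisms

variable {B C D : Crystal n} {g : B.carrier → C.carrier}

theorem isMorphism_id (B : Crystal n) : IsMorphism B B id where
  f i b := by rw [Option.map_id, id_eq, id_eq]
  phi _ _ := rfl
  eps _ _ := rfl

theorem IsMorphism.comp {h : C.carrier → D.carrier} (hh : IsMorphism C D h)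
    (hg : IsMorphism B C g) : IsMorphism B D (h ∘ g) where
  f i b := by rw [Function.comp_apply, hh.f, hg.f, Option.map_map]
  phi i b := by rw [Function.comp_apply, hh.phi, hg.phi]
  eps i b := by rw [Function.comp_apply, hh.eps, hg.eps]

theorem IsMorphism.inverse {h : C.carrier → B.carrier} (hg : IsMorphism B C g)
    (hl : Function.LeftInverse h g) (hr : Function.RightInverse h g) : IsMorphism C B h where
  f i c := by
    have := hg.f i (h c)
    rw [hr c] at this
    rw [this, Option.map_map, hl.comp_eq_id, Option.map_id, id_eq]
  phi i c := by rw [← hg.phi, hr c]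
  eps i c := by rw [← hg.eps, hr c]

theorem IsMorphism.tensor_id (hg : IsMorphism B C g) (D : Crystal n) :
    IsMorphism (B.tensor D) (C.tensor D) (fun b => (g b.1, b.2)) where
  f i b := by
    simp only [Crystal.tensor, hg.phi, hg.f]
    split_ifs <;> simp [Option.map_map, Function.comp_def]
  phi i b := by simp only [Crystal.tensor, hg.phi]
  eps i b := by simp only [Crystal.tensor, hg.phi, hg.eps]

theorem IsMorphism.id_tensor (hg : IsMorphism B C g) (D : Crystal n) :
    IsMorphism (D.tensor B) (D.tensor C) (fun b => (b.1, g b.2)) where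
  f i b := by
    simp only [Crystal.tensor, hg.eps, hg.f]
    split_ifs <;> simp [Option.map_map, Function.comp_def]
  phi i b := by simp only [Crystal.tensor, hg.phi, hg.eps]
  eps i b := by simp only [Crystal.tensor, hg.eps]

theorem isMorphism_assoc (B C D : Crystal n) :
    IsMorphism ((B.tensor C).tensor D) (B.tensor (C.tensor D)) (fun b => (b.1.1, b.1.2, b.2)) where
  f i := by
    rintro ⟨⟨b, c⟩, d⟩
    simp only [Crystal.tensor]
    split_ifs <;> first | omega | simp [Option.map_map, Function.comp_def]
  phi i b := by
    simp only [Crystal.tensor]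
    omega
  eps i b := by
    simp only [Crystal.tensor]
    omega

theorem IsMorphism.tensor_left {B' C' : Crystal n}
    {g : (B.tensor C).carrier → (B'.tensor C').carrier}
    (hg : IsMorphism (B.tensor C) (B'.tensor C') g) (D : Crystal n) :
    IsMorphism (B.tensor (C.tensor D)) (B'.tensor (C'.tensor D))
      (fun b => ((g (b.1, b.2.1)).1, (g (b.1, b.2.1)).2, b.2.2)) :=
  ((isMorphism_assoc B' C' D).comp ((hg.tensor_id D).comp
    ((isMorphism_assoc B C D).inverse
      (h := fun b : B.carrier × C.carrier × D.carrier => ((b.1, b.2.1), b.2.2))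
      (fun _ => rfl) (fun _ => rfl))) :)

end Morphisms

/-- Highest weight elements: those on which every `ε_i` vanishes. -/
def Crystal.IsHighest (B : Crystal n) (b : B.carrier) : Prop := ∀ i, B.eps i b = 0

theorem IsMorphism.isHighest {B C : Crystal n} {g : B.carrier → C.carrier}
    (hg : IsMorphism B C g) {b : B.carrier} (hb : B.IsHighest b) : C.IsHighest (g b) :=
  fun i => (hg.eps i b).trans (hb i)

theorem Crystal.isHighest_tensor_iff {B C : Crystal n} {b : B.carrier} {c : C.carrier} :
    (B.tensor C).IsHighest (b, c) ↔ B.IsHighest b ∧ ∀ i, C.eps i c ≤ B.phi i b := by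
  simp only [Crystal.IsHighest, ← forall_and]
  refine forall_congr' fun i => ?_
  rw [Crystal.tensor_eps]
  omega

theorem Crystal.IsNormal.ext {B C : Crystal n} {w : B.carrier → Fin n → ℕ} (hB : B.IsNormal w)
    {g h : B.carrier → C.carrier} (hg : IsMorphism B C g) (hh : IsMorphism B C h)
    (highest : ∀ b, B.IsHighest b → g b = h b) : g = h := by
  funext b
  induction hm : ∑ k : Fin n, k.1 * w b k using Nat.strong_induction_on generalizing b with
  | _ m ih =>
    by_cases hb : B.IsHighest b
    · exact highest b hb
    obtain ⟨i, hi⟩ := not_forall.1 hb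
    obtain ⟨c, hc⟩ := hB.exists_f (Nat.pos_of_ne_zero hi)
    have hlt : ∑ k : Fin n, k.1 * w c k < m := by
      have hsum := (hB.isShift hc).sum_mul (fun k => (k.1 : ℤ))
      simp only [ColouredBBS.lo, ColouredBBS.hi, Nat.cast_add, Nat.cast_one] at hsum
      zify
      rw [← hm]
      push_cast
      linarith
    have hgc := hg.f i c
    have hhc := hh.f i c
    rw [hc, ih _ hlt c rfl, hhc, hc] at hgc
    exact (Option.some.inj hgc).symm

theorem Crystal.IsNormal.eq_id {B : Crystal n} {w : B.carrier → Fin n → ℕ} (hB : B.IsNormal w)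
    {g : B.carrier → B.carrier} (hg : IsMorphism B B g) (hinj : Function.Injective g)
    (hw : ∀ b, w (g b) = w b)
    (highest : ∀ b c, B.IsHighest b → B.IsHighest c → w b = w c → b = c ∨ g b = b ∨ g c = c) :
    g = id := by
  refine hB.ext hg (isMorphism_id B) fun b hb => ?_
  rcases highest b (g b) hb (hg.isHighest hb) (hw b).symm with h | h | h
  · exact h.symm
  · exact h
  · exact hinj h

end Crystals

section RowCrystal

variable {n ℓ : ℕ}

theorem rowF_eq_none_iff {i : Fin (n - 1)} {x : Row n ℓ} : rowF i x = none ↔ x.1 (lo i) = 0 := by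
  simp [rowF]

theorem isShift_of_rowF {i : Fin (n - 1)} {x y : Row n ℓ} (h : rowF i x = some y) :
    IsShift i 1 x.1 y.1 := by
  simp only [rowF, Option.dite_none_right_eq_some, Option.some.injEq] at h
  obtain ⟨hpos, rfl⟩ := h
  have := lo_ne_hi i
  constructor
  · simp only [if_neg this, if_pos]
    omega
  · simp only [if_neg this.symm, if_pos]
    omega
  · intro k hlo hhi
    simp [hlo, hhi]

theorem rowCrystal_isContentDetermined (n ℓ : ℕ) :
    (rowCrystal n ℓ).IsContentDetermined Subtype.val :=
  .of_isShift Subtype.val_injective isShift_of_rowF fun {i x _} h hx => by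
    have := h.apply_lo
    have : x.1 (lo i) = 0 := rowF_eq_none_iff.1 hx
    omega

theorem exists_isShift_of_pos {i : Fin (n - 1)} {y : Row n ℓ} (h : 0 < y.1 (hi i)) :
    ∃ x : Row n ℓ, IsShift i 1 x.1 y.1 := by
  have hne := lo_ne_hi i
  refine ⟨⟨fun k => y.1 k + (if k = lo i then 1 else 0) - (if k = hi i then 1 else 0), ?_⟩, ?_⟩
  · rw [sum_exchange _ _ _ (by simp), y.2]
    intro k
    by_cases hk : k = hi i
    · subst hk; simp only [if_pos]; omega
    · simp [hk]
  · constructor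
    · simp only [if_neg hne, if_pos]
      omega
    · simp only [if_neg hne.symm, if_pos]
      omega
    · intro k hlo hhi
      simp [hlo, hhi]

theorem rowCrystal_isNormal (n ℓ : ℕ) : (rowCrystal n ℓ).IsNormal Subtype.val where
  phi_of_none := rowF_eq_none_iff.1
  phi_of_some {i x y} h := by
    have := (isShift_of_rowF h).apply_lo
    change x.1 (lo i) = y.1 (lo i) + 1
    omega
  exists_f h :=
    (exists_isShift_of_pos h).imp fun _ => (rowCrystal_isContentDetermined n ℓ).f_eq_some_iff.2
  isShift := isShift_of_rowF
  phi_add _ _ := Nat.add_comm _ _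

end RowCrystal

section DominoCrystal

variable {n : ℕ}

theorem colCount_eq (d : Domino n) (k : Fin n) : colCount d.1 k = if d.Has k then 1 else 0 := by
  have := d.2.ne
  simp only [colCount, Domino.Has]
  split_ifs <;> simp_all

theorem colCount_eq_one_iff {d : Domino n} {k : Fin n} : colCount d.1 k = 1 ↔ d.Has k := by
  simp [colCount_eq]

theorem colCount_eq_zero_iff {d : Domino n} {k : Fin n} : colCount d.1 k = 0 ↔ ¬ d.Has k := by
  simp [colCount_eq]

theorem colCount_le_one (d : Domino n) (k : Fin n) : colCount d.1 k ≤ 1 := by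
  rw [colCount_eq]
  split_ifs <;> omega

theorem colCount_injective : Function.Injective fun d : Domino n => colCount d.1 := by
  intro d e h
  have hiff (k : Fin n) : d.Has k ↔ e.Has k := by
    rw [← colCount_eq_one_iff, ← colCount_eq_one_iff, show colCount d.1 = colCount e.1 from h]
  obtain ⟨⟨a, b⟩, hab⟩ := d
  obtain ⟨⟨a', b'⟩, hab'⟩ := e
  have : a = a' ∨ a = b' := (hiff a).1 (.inl rfl)
  have : b = a' ∨ b = b' := (hiff b).1 (.inr rfl)
  have : a' = a ∨ a' = b := (hiff a').2 (.inl rfl)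
  have : b' = a ∨ b' = b := (hiff b').2 (.inr rfl)
  apply Subtype.ext
  grind

theorem dominoCrystal_phi (i : Fin (n - 1)) (d : Domino n) :
    (dominoCrystal n).phi i d = colCount d.1 (lo i) - colCount d.1 (hi i) := by
  simp only [dominoCrystal, colCount_eq]
  split_ifs <;> first | rfl | tauto

theorem dominoCrystal_eps (i : Fin (n - 1)) (d : Domino n) :
    (dominoCrystal n).eps i d = colCount d.1 (hi i) - colCount d.1 (lo i) := by
  simp only [dominoCrystal, colCount_eq]
  split_ifs <;> first | rfl | tauto

theorem dominoF_eq_none_iff {i : Fin (n - 1)} {d : Domino n} :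
    dominoF i d = none ↔ (dominoCrystal n).phi i d = 0 := by
  simp [dominoF, dominoCrystal]

theorem isShift_of_dominoF {i : Fin (n - 1)} {d e : Domino n} (h : dominoF i d = some e) :
    IsShift i 1 (colCount d.1) (colCount e.1) := by
  simp only [dominoF, Option.dite_none_right_eq_some, Option.some.injEq] at h
  obtain ⟨⟨hlo, hhi⟩, rfl⟩ := h
  have := lo_ne_hi i
  have := d.2.ne
  simp only [Domino.Has] at hlo hhi
  constructor <;> simp only [colCount] <;> grind

theorem IsShift.colCount {i : Fin (n - 1)} {d e : Domino n}
    (h : IsShift i 1 (colCount d.1) (colCount e.1)) :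
    colCount d.1 (lo i) = 1 ∧ colCount d.1 (hi i) = 0 ∧
      colCount e.1 (lo i) = 0 ∧ colCount e.1 (hi i) = 1 := by
  have := h.apply_lo
  have := h.apply_hi
  have := colCount_le_one d (lo i)
  have := colCount_le_one e (hi i)
  omega

theorem dominoCrystal_isContentDetermined (n : ℕ) :
    (dominoCrystal n).IsContentDetermined fun d => colCount d.1 :=
  .of_isShift colCount_injective isShift_of_dominoF fun {i d _} h hd => by
    have := h.colCount
    have := (dominoCrystal_phi i d).symm.trans (dominoF_eq_none_iff.1 hd)
    omega

theorem exists_isShift_of_eps_pos {i : Fin (n - 1)} {e : Domino n}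
    (h : 0 < (dominoCrystal n).eps i e) :
    ∃ d : Domino n, IsShift i 1 (colCount d.1) (colCount e.1) := by
  rw [dominoCrystal_eps] at h
  have hne := lo_ne_hi i
  have hhi : e.Has (hi i) := colCount_eq_one_iff.1 (by have := colCount_le_one e (hi i); omega)
  have hlo : ¬ e.Has (lo i) := colCount_eq_zero_iff.1 (by have := colCount_le_one e (hi i); omega)
  obtain ⟨⟨a, b⟩, hab⟩ := e
  simp only [Domino.Has] at hhi hlo
  refine ⟨⟨(if a = hi i then lo i else a, if b = hi i then lo i else b), ?_⟩, ?_⟩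
  · simp only [lo, hi, Fin.ext_iff, Fin.lt_def] at hlo hhi hab ⊢
    split_ifs <;> simp_all <;> omega
  · constructor <;> simp only [colCount] <;> grind

theorem dominoCrystal_isNormal (n : ℕ) : (dominoCrystal n).IsNormal fun d => colCount d.1 where
  phi_of_none := dominoF_eq_none_iff.1
  phi_of_some {i d e} h := by
    have := (isShift_of_dominoF h).colCount
    have := dominoCrystal_phi i d
    have := dominoCrystal_phi i e
    omega
  exists_f h :=
    (exists_isShift_of_eps_pos h).imp fun _ => (dominoCrystal_isContentDetermined n).f_eq_some_iff.2
  isShift := isShift_of_dominoF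
  phi_add i d := by
    have := dominoCrystal_phi i d
    have := dominoCrystal_eps i d
    change (dominoCrystal n).phi i d + colCount d.1 (hi i) =
      (dominoCrystal n).eps i d + colCount d.1 (lo i)
    omega

end DominoCrystal

section Cyclic

variable {n : ℕ} [NeZero n]

theorem lo_add_one (i : Fin (n - 1)) : (lo i : Fin n) + 1 = hi i := by
  have := i.2
  apply Fin.ext
  rw [Fin.val_add_one_of_lt' (by simp only [lo]; omega)]
  rfl

theorem hi_add_one_ne_hi (i : Fin (n - 1)) : (hi i : Fin n) + 1 ≠ hi i := by
  intro h
  have : (1 : Fin n) = 0 := add_eq_left.1 h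
  exact lo_ne_hi i (by rw [← lo_add_one, this, add_zero])

theorem add_one_ne_hi {i : Fin (n - 1)} {k : Fin n} (hk : k ≠ lo i) : k + 1 ≠ hi i := fun h =>
  hk (add_right_cancel (h.trans (lo_add_one i).symm))

theorem eq_of_le_add_one {α : Type*} [PartialOrder α] {f : Fin n → α} (h : ∀ k, f k ≤ f (k + 1))
    (i j : Fin n) : f i = f j := by
  have le_add (i : Fin n) (m : ℕ) : f i ≤ f (i + Fin.ofNat n m) := by
    induction m generalizing i with
    | zero => simp
    | succ m ih => rw [ofNat_succ_aux]; exact (h i).trans (ih (i + 1))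
  have le (i j : Fin n) : f i ≤ f j := by
    simpa using le_add i (j - i).1
  exact le_antisymm (le i j) (le j i)

end Cyclic

section Transports

variable {n : ℕ} [NeZero n]

/-- A carrier with load `c k` on arrival at the letter `k` turns the pair of rows with letter
counts `(x, y)` into the pair `(y', x')`; it visits the letters in decreasing cyclic order. -/
structure Transports (c : Fin n → ℤ) (x y y' x' : Fin n → ℕ) : Prop where
  apply_fst : ∀ k, (y' k : ℤ) = y k + c (k + 1) - c k
  apply_snd : ∀ k, (x' k : ℤ) = x k + c k - c (k + 1)

variable {c c' : Fin n → ℤ} {x y y' x' : Fin n → ℕ}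

theorem Transports.symm (h : Transports c x y y' x') : Transports c y' x' x y where
  apply_fst k := by linarith [h.apply_snd k]
  apply_snd k := by linarith [h.apply_fst k]

theorem Transports.congr (h : Transports c x y y' x')
    (hc : ∀ k, c k - c (k + 1) = c' k - c' (k + 1)) : Transports c' x y y' x' where
  apply_fst k := by linarith [h.apply_fst k, hc k]
  apply_snd k := by linarith [h.apply_snd k, hc k]

theorem Transports.fst_unique {z' w' : Fin n → ℕ} (h : Transports c x y y' x')
    (h' : Transports c x y z' w') : y' = z' :=
  funext fun k => by exact_mod_cast (h.apply_fst k).trans (h'.apply_fst k).symm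

theorem Transports.snd_unique {z' w' : Fin n → ℕ} (h : Transports c x y y' x')
    (h' : Transports c x y z' w') : x' = w' :=
  funext fun k => by exact_mod_cast (h.apply_snd k).trans (h'.apply_snd k).symm

theorem Transports.add_eq (h : Transports c x y y' x') (k : Fin n) : y' k + x' k = x k + y k := by
  have := h.apply_fst k
  have := h.apply_snd k
  omega

theorem Transports.isShift {i : Fin (n - 1)} {s t u : ℤ} {z w w' z' : Fin n → ℕ}
    (h : Transports c x y y' x') (hx : IsShift i s x z) (hy : IsShift i t y w)
    (h' : Transports (Function.update c (hi i) (c (hi i) + u)) z w w' z') :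
    IsShift i (t - u) y' w' ∧ IsShift i (s + u) x' z' := by
  have hlo := lo_add_one i ▸ h'.apply_fst (lo i)
  have hlo' := lo_add_one i ▸ h'.apply_snd (lo i)
  have hhi := h'.apply_fst (hi i)
  have hhi' := h'.apply_snd (hi i)
  rw [Function.update_self, Function.update_of_ne (lo_ne_hi i)] at hlo hlo'
  rw [Function.update_self, Function.update_of_ne (hi_add_one_ne_hi i)] at hhi hhi'
  refine ⟨⟨?_, ?_, fun k h₁ h₂ => ?_⟩, ⟨?_, ?_, fun k h₁ h₂ => ?_⟩⟩
  · linarith [lo_add_one i ▸ h.apply_fst (lo i), hy.apply_lo]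
  · linarith [h.apply_fst (hi i), hy.apply_hi]
  · have := h'.apply_fst k
    rw [hy.apply_of_ne k h₁ h₂, Function.update_of_ne h₂,
      Function.update_of_ne (add_one_ne_hi h₁), ← h.apply_fst k] at this
    exact_mod_cast this
  · linarith [lo_add_one i ▸ h.apply_snd (lo i), hx.apply_lo]
  · linarith [h.apply_snd (hi i), hx.apply_hi]
  · have := h'.apply_snd k
    rw [hx.apply_of_ne k h₁ h₂, Function.update_of_ne h₂,
      Function.update_of_ne (add_one_ne_hi h₁), ← h.apply_snd k] at this
    exact_mod_cast this

end Transports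

section RowCarriers

variable {n : ℕ} [NeZero n]

/-- The load of a carrier that turns the row `x` into the row `y` cyclically: at the letter `k` it
drops up to `x k` of its letters and picks up `y k` new ones. -/
def IsRowCarrier (x y : Fin n → ℕ) (p : Fin n → ℤ) : Prop :=
  ∀ k, p k = y k + max 0 (p (k + 1) - x k)

/-- The load of a carrier as in `IsRowCarrier` that moves through the letters in the opposite
direction, with the roles of `x` and `y` exchanged. -/
def IsRowCocarrier (x y : Fin n → ℕ) (p : Fin n → ℤ) : Prop :=
  ∀ k, p (k + 1) = x k + max 0 (p k - y k)

variable {x y y' x' : Fin n → ℕ} {p q : Fin n → ℤ}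

theorem IsRowCarrier.isRowCocarrier (hp : IsRowCarrier x y p) (h : Transports p x y y' x') :
    IsRowCocarrier y' x' p := fun k => by
  have := hp k
  have := h.apply_fst k
  have := h.apply_snd k
  omega

theorem IsRowCocarrier.isRowCarrier (hp : IsRowCocarrier x y p) (h : Transports p x y y' x') :
    IsRowCarrier y' x' p := fun k => by
  have := hp k
  have := h.apply_fst k
  have := h.apply_snd k
  omega

theorem IsRowCarrier.sub_eq_sub (hp : IsRowCarrier x y p) (hq : IsRowCarrier x y q) (k : Fin n) :
    p k - p (k + 1) = q k - q (k + 1) := by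
  have natAbs_eq : (p k - q k).natAbs = (p (k + 1) - q (k + 1)).natAbs :=
    eq_of_le_add_one (f := fun k => (p k - q k).natAbs) (fun k => by
      have := hp k
      have := hq k
      omega) k (k + 1)
  have := hp k
  have := hq k
  omega

theorem IsRowCocarrier.sub_eq_sub (hp : IsRowCocarrier x y p) (hq : IsRowCocarrier x y q)
    (k : Fin n) : p k - p (k + 1) = q k - q (k + 1) := by
  have natAbs_eq : (p k - q k).natAbs = (p (k + 1) - q (k + 1)).natAbs :=
    eq_of_le_add_one (f := fun k => OrderDual.toDual (p k - q k).natAbs) (fun k => by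
      have := hp k
      have := hq k
      rw [OrderDual.toDual_le_toDual]
      omega) k (k + 1)
  have := hp k
  have := hq k
  omega

theorem IsRowCarrier.exists_update {i : Fin (n - 1)} {s t : ℤ} {z w : Fin n → ℕ}
    (hp : IsRowCarrier x y p) (h : Transports p x y y' x') (hx : IsShift i s x z)
    (hy : IsShift i t y w) (hst : SignatureRule s t (x (lo i)) (y (hi i))) :
    ∃ u, IsRowCarrier z w (Function.update p (hi i) (p (hi i) + u)) ∧
      SignatureRule (t - u) (s + u) (y' (lo i)) (x' (hi i)) := by
  have hplo := lo_add_one i ▸ hp (lo i)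
  have hphi := hp (hi i)
  have := hx.apply_lo
  have := hx.apply_hi
  have := hy.apply_lo
  have := hy.apply_hi
  refine ⟨w (hi i) + max 0 (p (hi i + 1) - z (hi i)) - p (hi i), fun k => ?_, ?_⟩
  · by_cases hhi : k = hi i
    · rw [hhi, Function.update_self, Function.update_of_ne (hi_add_one_ne_hi i)]
      omega
    by_cases hlo : k = lo i
    · rw [Function.update_of_ne hhi, hlo, lo_add_one, Function.update_self]
      rcases hst with ⟨rfl, rfl, hst⟩ | ⟨rfl, rfl, hst⟩ <;> omega
    · rw [Function.update_of_ne hhi, Function.update_of_ne (add_one_ne_hi hlo),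
        hx.apply_of_ne k hlo hhi, hy.apply_of_ne k hlo hhi]
      exact hp k
  · have := lo_add_one i ▸ h.apply_fst (lo i)
    have := h.apply_snd (hi i)
    unfold SignatureRule
    rcases hst with ⟨rfl, rfl, hst⟩ | ⟨rfl, rfl, hst⟩ <;> omega

end RowCarriers

section CombinatorialR

variable {n : ℕ} [NeZero n] {ℓ m : ℕ}

theorem term_self (x y : Fin n → ℕ) (i : Fin n) :
    term x y i n = ∑ k, ((y k : ℤ) - x k) + y i := by
  rw [term, sum_cyclic fun k => (y k : ℤ) - x k]
  congr 3
  ext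
  simp

theorem max_P (x y : Fin n → ℕ) (i : Fin n) :
    max (P x y i) (∑ k, ((y k : ℤ) - x k) + y i) = y i + max 0 (P x y (i + 1) - x i) := by
  have hn : n - 1 + 1 = n := Nat.sub_add_cancel NeZero.one_le
  have term_le (j : ℕ) (hj : j < n) : term x y i j ≤ P x y i := term_le_P x y i hj
  have term_succ_le (j : ℕ) (hj : j < n) :
      term x y i (j + 1) ≤ y i - x i + P x y (i + 1) := by
    rw [term_succ]
    exact add_le_add_right (term_le_P x y (i + 1) hj) _
  have P_le : P x y i ≤ y i + max 0 (P x y (i + 1) - x i) := by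
    refine Finset.sup'_le _ _ fun j hj => ?_
    have hj := Finset.mem_range.1 hj
    cases j with
    | zero => rw [term_zero]; omega
    | succ j => have := term_succ_le j (by omega); omega
  have P_add_one_le :
      P x y (i + 1) ≤ x i - y i + max (P x y i) (∑ k, ((y k : ℤ) - x k) + y i) := by
    refine Finset.sup'_le _ _ fun j hj => ?_
    have hsucc := term_succ x y i j
    rcases (Nat.succ_le_of_lt (Finset.mem_range.1 hj)).lt_or_eq with hj | hj
    · have := term_le (j + 1) hj; omega
    · rw [← Nat.succ_eq_add_one, hj, term_self] at hsucc; omega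
  have := term_zero x y i ▸ term_le 0 (by omega)
  have := term_self x y i ▸ hn ▸ term_succ_le (n - 1) (by omega)
  omega

theorem sum_sub_add_le_P (x y : Fin n → ℕ) (i : Fin n) :
    ∑ k, ((y k : ℤ) - x k) + x i ≤ P x y (i + 1) := by
  have hn : n - 1 + 1 = n := Nat.sub_add_cancel NeZero.one_le
  have := term_succ x y i (n - 1)
  rw [hn, term_self] at this
  have := term_le_P x y (i + 1) (j := n - 1) (by omega)
  omega

theorem isRowCarrier_P {x y : Fin n → ℕ} (h : ∑ k, y k ≤ ∑ k, x k) :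
    IsRowCarrier x y (P x y) := fun k => by
  have sum_nonpos : ∑ k, ((y k : ℤ) - x k) ≤ 0 := by
    rw [Finset.sum_sub_distrib, sub_nonpos]
    exact_mod_cast h
  have := max_P x y k
  have := term_zero x y k ▸ term_le_P x y k (NeZero.pos n)
  omega

theorem isRowCocarrier_P_sub {x y : Fin n → ℕ} (h : ∑ k, x k ≤ ∑ k, y k) :
    IsRowCocarrier x y fun k => P x y k - ∑ k, ((y k : ℤ) - x k) := fun k => by
  have sum_nonneg : 0 ≤ ∑ k, ((y k : ℤ) - x k) := by
    rw [Finset.sum_sub_distrib, sub_nonneg]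
    exact_mod_cast h
  have := max_P x y k
  have := sum_sub_add_le_P x y k
  dsimp only
  omega

theorem R_transports (b : Row n ℓ × Row n m) :
    Transports (P b.1.1 b.2.1) b.1.1 b.2.1 (R n ℓ m b).1.1 (R n ℓ m b).2.1 where
  apply_fst k := Int.toNat_of_nonneg (R_fst_nonneg b.1.1 b.2.1 k)
  apply_snd k := Int.toNat_of_nonneg (R_snd_nonneg b.1.1 b.2.1 k)

theorem R_eq_of_isRowCarrier (hmℓ : m ≤ ℓ) {x x' : Row n ℓ} {y y' : Row n m} {p : Fin n → ℤ}
    (hp : IsRowCarrier x.1 y.1 p) (h : Transports p x.1 y.1 y'.1 x'.1) :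
    R n ℓ m (x, y) = (y', x') := by
  have hP : IsRowCarrier x.1 y.1 (P x.1 y.1) := isRowCarrier_P (by rwa [x.2, y.2])
  have h' := (R_transports (x, y)).congr (hP.sub_eq_sub hp)
  exact Prod.ext (Subtype.ext (h'.fst_unique h)) (Subtype.ext (h'.snd_unique h))

theorem R_eq_of_isRowCocarrier (hℓm : ℓ ≤ m) {x x' : Row n ℓ} {y y' : Row n m} {p : Fin n → ℤ}
    (hp : IsRowCocarrier x.1 y.1 p) (h : Transports p x.1 y.1 y'.1 x'.1) :
    R n ℓ m (x, y) = (y', x') := by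
  have hP := isRowCocarrier_P_sub (x := x.1) (y := y.1) (by rwa [x.2, y.2])
  have h' := (R_transports (x, y)).congr fun k =>
    (sub_sub_sub_cancel_right _ _ _).symm.trans (hP.sub_eq_sub hp k)
  exact Prod.ext (Subtype.ext (h'.fst_unique h)) (Subtype.ext (h'.snd_unique h))

theorem R_R (ℓ m : ℕ) (b : Row n ℓ × Row n m) : R n m ℓ (R n ℓ m b) = b := by
  have h := R_transports b
  rcases le_total m ℓ with hmℓ | hℓm
  · have hP : IsRowCarrier b.1.1 b.2.1 (P b.1.1 b.2.1) :=
      isRowCarrier_P (by rwa [b.1.2, b.2.2])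
    exact R_eq_of_isRowCocarrier hmℓ (hP.isRowCocarrier h) h.symm
  · have hP := isRowCocarrier_P_sub (x := b.1.1) (y := b.2.1) (by rwa [b.1.2, b.2.2])
    have h := h.congr fun k =>
      (sub_sub_sub_cancel_right _ _ (∑ k, ((b.2.1 k : ℤ) - b.1.1 k))).symm
    exact R_eq_of_isRowCarrier hℓm (hP.isRowCarrier h) h.symm

theorem R_f_of_le (hmℓ : m ≤ ℓ) {i : Fin (n - 1)} {b b' : Row n ℓ × Row n m}
    (hb : ((rowCrystal n ℓ).tensor (rowCrystal n m)).f i b = some b') :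
    ((rowCrystal n m).tensor (rowCrystal n ℓ)).f i (R n ℓ m b) = some (R n ℓ m b') := by
  have hℓ := rowCrystal_isContentDetermined n ℓ
  have hm := rowCrystal_isContentDetermined n m
  obtain ⟨s, t, hs, ht, hst⟩ := (hℓ.tensor_f_eq_some_iff hm).1 hb
  have hP : IsRowCarrier b.1.1 b.2.1 (P b.1.1 b.2.1) := isRowCarrier_P (by rwa [b.1.2, b.2.2])
  have hP' : IsRowCarrier b'.1.1 b'.2.1 (P b'.1.1 b'.2.1) :=
    isRowCarrier_P (by rwa [b'.1.2, b'.2.2])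
  obtain ⟨u, hu, hst'⟩ := hP.exists_update (R_transports b) hs ht hst
  obtain ⟨hs', ht'⟩ := (R_transports b).isShift hs ht
    ((R_transports b').congr (hP'.sub_eq_sub hu))
  exact (hm.tensor_f_eq_some_iff hℓ).2 ⟨_, _, hs', ht', hst'⟩

theorem R_phi_of_le (hmℓ : m ≤ ℓ) (i : Fin (n - 1)) (b : Row n ℓ × Row n m) :
    ((rowCrystal n m).tensor (rowCrystal n ℓ)).phi i (R n ℓ m b) =
      ((rowCrystal n ℓ).tensor (rowCrystal n m)).phi i b := by
  have hP : IsRowCarrier b.1.1 b.2.1 (P b.1.1 b.2.1) := isRowCarrier_P (by rwa [b.1.2, b.2.2])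
  have := lo_add_one i ▸ hP (lo i)
  have := hP (hi i)
  have h := R_transports b
  have := lo_add_one i ▸ h.apply_fst (lo i)
  have := lo_add_one i ▸ h.apply_snd (lo i)
  have := h.apply_fst (hi i)
  have := h.apply_snd (hi i)
  simp only [Crystal.tensor, rowCrystal]
  omega

theorem R_isMorphism (ℓ m : ℕ) :
    IsMorphism ((rowCrystal n ℓ).tensor (rowCrystal n m))
      ((rowCrystal n m).tensor (rowCrystal n ℓ)) (R n ℓ m) := by
  have isMorphism_of_le {ℓ m : ℕ} (hmℓ : m ≤ ℓ) :
      IsMorphism ((rowCrystal n ℓ).tensor (rowCrystal n m))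
        ((rowCrystal n m).tensor (rowCrystal n ℓ)) (R n ℓ m) :=
    ((rowCrystal_isNormal n ℓ).tensor (rowCrystal_isNormal n m)).isMorphism
      ((rowCrystal_isNormal n m).tensor (rowCrystal_isNormal n ℓ))
      (fun b => funext (R_transports b).add_eq) (R_phi_of_le hmℓ) (fun _ _ _ => R_f_of_le hmℓ)
  rcases le_total m ℓ with hmℓ | hℓm
  · exact isMorphism_of_le hmℓ
  · exact (isMorphism_of_le hℓm).inverse (R_R m ℓ) (R_R ℓ m)

end CombinatorialR

section ColCarriers

variable {n : ℕ} [NeZero n]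

/-- The load of a carrier with room for a single letter that visits the letters in decreasing
cyclic order: on leaving the letter `k` it holds one if it has just picked it up from the column
`d`, or if it arrived with one and the row `x` has no letter `k` to exchange for it. -/
structure IsColCarrier (x : Fin n → ℕ) (d : Domino n) (c : Fin n → ℤ) : Prop where
  eq_max : ∀ k, c k = max (colCount d.1 k : ℤ) (c (k + 1) - x k)
  le_one : ∀ k, c k ≤ 1

/-- The load of a carrier as in `IsColCarrier` that visits the letters in increasing cyclic
order. -/
structure IsColCocarrier (x : Fin n → ℕ) (d : Domino n) (c : Fin n → ℤ) : Prop where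
  eq_max : ∀ k, c (k + 1) = max (colCount d.1 k : ℤ) (c k - x k)
  le_one : ∀ k, c k ≤ 1

variable {x x' : Fin n → ℕ} {d d' : Domino n} {c c' : Fin n → ℤ}

theorem IsColCarrier.nonneg (hc : IsColCarrier x d c) (k : Fin n) : 0 ≤ c k := by
  have := hc.eq_max k
  omega

theorem IsColCarrier.isColCocarrier (hc : IsColCarrier x d c)
    (h : Transports c x (colCount d.1) (colCount d'.1) x') : IsColCocarrier x' d' c where
  eq_max k := by
    have := hc.eq_max k
    have := h.apply_fst k
    have := h.apply_snd k
    have := hc.le_one (k + 1)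
    omega
  le_one := hc.le_one

theorem IsColCocarrier.isColCarrier (hc : IsColCocarrier x d c)
    (h : Transports c (colCount d.1) x x' (colCount d'.1)) : IsColCarrier x' d' c where
  eq_max k := by
    have := hc.eq_max k
    have := h.apply_fst k
    have := h.apply_snd k
    have := hc.le_one k
    omega
  le_one := hc.le_one

theorem IsColCarrier.unique (hc : IsColCarrier x d c) (hc' : IsColCarrier x d c') : c = c' := by
  have eq_fst : c d.1.1 = c' d.1.1 := by
    have := colCount_eq_one_iff.2 (.inl rfl : d.Has d.1.1)
    have := hc.eq_max d.1.1
    have := hc.le_one d.1.1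
    have := hc'.eq_max d.1.1
    have := hc'.le_one d.1.1
    omega
  have natAbs_eq (k : Fin n) : (c k - c' k).natAbs = (c d.1.1 - c' d.1.1).natAbs :=
    eq_of_le_add_one (f := fun k => (c k - c' k).natAbs) (fun k => by
      have := hc.eq_max k
      have := hc'.eq_max k
      omega) k d.1.1
  funext k
  have := natAbs_eq k
  omega

theorem IsColCocarrier.unique (hc : IsColCocarrier x d c) (hc' : IsColCocarrier x d c') :
    c = c' := by
  have eq_fst : c (d.1.1 + 1) = c' (d.1.1 + 1) := by
    have := colCount_eq_one_iff.2 (.inl rfl : d.Has d.1.1)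
    have := hc.eq_max d.1.1
    have := hc.le_one (d.1.1 + 1)
    have := hc'.eq_max d.1.1
    have := hc'.le_one (d.1.1 + 1)
    omega
  have natAbs_eq (k : Fin n) : (c k - c' k).natAbs = (c (d.1.1 + 1) - c' (d.1.1 + 1)).natAbs :=
    eq_of_le_add_one (f := fun k => OrderDual.toDual (c k - c' k).natAbs) (fun k => by
      have := hc.eq_max k
      have := hc'.eq_max k
      rw [OrderDual.toDual_le_toDual]
      omega) k (d.1.1 + 1)
  funext k
  have := natAbs_eq k
  omega

theorem IsColCarrier.update {i : Fin (n - 1)} {s t v : ℤ} {z : Fin n → ℕ} {e : Domino n}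
    (hc : IsColCarrier x d c) (hx : IsShift i s x z)
    (hd : IsShift i t (colCount d.1) (colCount e.1))
    (hlo : c (lo i) = max (colCount e.1 (lo i) : ℤ) (v - z (lo i)))
    (hhi : v = max (colCount e.1 (hi i) : ℤ) (c (hi i + 1) - z (hi i))) :
    IsColCarrier z e (Function.update c (hi i) v) where
  eq_max k := by
    by_cases hk_hi : k = hi i
    · rwa [hk_hi, Function.update_self, Function.update_of_ne (hi_add_one_ne_hi i)]
    by_cases hk_lo : k = lo i
    · rwa [Function.update_of_ne hk_hi, hk_lo, lo_add_one, Function.update_self]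
    · rw [Function.update_of_ne hk_hi, Function.update_of_ne (add_one_ne_hi hk_lo),
        hx.apply_of_ne k hk_lo hk_hi, hd.apply_of_ne k hk_lo hk_hi]
      exact hc.eq_max k
  le_one k := by
    by_cases hk : k = hi i
    · rw [hk, Function.update_self]
      have := colCount_le_one e (hi i)
      have := hc.le_one (hi i + 1)
      omega
    · rw [Function.update_of_ne hk]
      exact hc.le_one k

theorem IsColCarrier.exists_update {i : Fin (n - 1)} {s t : ℤ} {z : Fin n → ℕ} {e : Domino n}
    (hc : IsColCarrier x d c) (h : Transports c x (colCount d.1) (colCount d'.1) x')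
    (hx : IsShift i s x z) (hd : IsShift i t (colCount d.1) (colCount e.1))
    (hst : SignatureRule s t (x (lo i)) ((dominoCrystal n).eps i d)) :
    ∃ u, IsColCarrier z e (Function.update c (hi i) (c (hi i) + u)) ∧
      SignatureRule (t - u) (s + u) ((dominoCrystal n).phi i d') (x' (hi i)) := by
  have hclo := lo_add_one i ▸ hc.eq_max (lo i)
  have hchi := hc.eq_max (hi i)
  have := hc.le_one (lo i)
  have := hc.le_one (hi i)
  have := hc.le_one (hi i + 1)
  have := hx.apply_lo
  have := hx.apply_hi
  have := hd.apply_lo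
  have := hd.apply_hi
  have := colCount_le_one e (hi i)
  have := dominoCrystal_eps i d
  obtain ⟨v, hv⟩ : ∃ v, v = max (colCount e.1 (hi i) : ℤ) (c (hi i + 1) - z (hi i)) := ⟨_, rfl⟩
  refine ⟨v - c (hi i), (add_sub_cancel (c (hi i)) v).symm ▸ hc.update hx hd ?_ hv, ?_⟩
  · rcases hst with ⟨rfl, rfl, hst⟩ | ⟨rfl, rfl, hst⟩ <;> omega
  · have := lo_add_one i ▸ h.apply_fst (lo i)
    have := h.apply_fst (hi i)
    have := h.apply_snd (hi i)
    have := dominoCrystal_phi i d'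
    unfold SignatureRule
    rcases hst with ⟨rfl, rfl, hst⟩ | ⟨rfl, rfl, hst⟩ <;> omega

end ColCarriers

section NearestLetters

variable {n : ℕ} {x : Fin n → ℕ} {b k : Fin n}

theorem letters_nonempty {ℓ : ℕ} (hℓ : 1 ≤ ℓ) (x : Row n ℓ) : (letters x.1).Nonempty := by
  have sum_ne_zero : ∑ k, x.1 k ≠ 0 := by rw [x.2]; omega
  obtain ⟨k, -, hk⟩ := Finset.exists_ne_zero_of_sum_ne_zero sum_ne_zero
  exact ⟨k, by simpa [letters] using Nat.pos_of_ne_zero hk⟩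

theorem max'_letters_pos (h : (letters x).Nonempty) : 0 < x ((letters x).max' h) := by
  simpa [letters] using (letters x).max'_mem h

theorem min'_letters_pos (h : (letters x).Nonempty) : 0 < x ((letters x).min' h) := by
  simpa [letters] using (letters x).min'_mem h

theorem le_max'_letters (h : (letters x).Nonempty) (hk : 0 < x k) : k ≤ (letters x).max' h :=
  Finset.le_max' _ _ (by simpa [letters] using hk)

theorem min'_letters_le (h : (letters x).Nonempty) (hk : 0 < x k) : (letters x).min' h ≤ k :=
  Finset.min'_le _ _ (by simpa [letters] using hk)

theorem max'_below_spec (h : (below x b).Nonempty) :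
    0 < x ((below x b).max' h) ∧ (below x b).max' h < b := by
  simpa [below] using (below x b).max'_mem h

theorem min'_above_spec (h : (above x b).Nonempty) :
    0 < x ((above x b).min' h) ∧ b < (above x b).min' h := by
  simpa [above] using (above x b).min'_mem h

theorem le_max'_below (h : (below x b).Nonempty) (hk : 0 < x k) (hkb : k < b) :
    k ≤ (below x b).max' h :=
  Finset.le_max' _ _ (by simp [below, hk, hkb])

theorem min'_above_le (h : (above x b).Nonempty) (hk : 0 < x k) (hbk : b < k) :
    (above x b).min' h ≤ k :=
  Finset.min'_le _ _ (by simp [above, hk, hbk])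

theorem le_of_below_empty (h : ¬ (below x b).Nonempty) (hk : 0 < x k) : b ≤ k :=
  not_lt.1 fun hkb => h ⟨k, by simp [below, hk, hkb]⟩

theorem le_of_above_empty (h : ¬ (above x b).Nonempty) (hk : 0 < x k) : k ≤ b :=
  not_lt.1 fun hbk => h ⟨k, by simp [above, hk, hbk]⟩

end NearestLetters

section Arcs

variable {n : ℕ} [NeZero n] {x : Fin n → ℕ} {b : Fin n} {d : Domino n} {S T : Fin n → Prop}
  [DecidablePred S] [DecidablePred T]

theorem val_add_one_eq (k : Fin n) :
    (k + 1).1 = k.1 + 1 ∧ k.1 + 1 < n ∨ (k + 1).1 = 0 ∧ k.1 + 1 = n := by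
  rcases Nat.lt_or_ge (k.1 + 1) n with h | h
  · exact .inl ⟨Fin.val_add_one_of_lt' h, h⟩
  · have hk : k.1 + 1 = n := le_antisymm k.2 h
    exact .inr ⟨by rw [Fin.val_add, Fin.val_one', Nat.add_mod_mod, hk, Nat.mod_self], hk⟩

/-- The set `S` of the letters that a carrier leaves with the letter `b` on board, if it visits the
letters in decreasing cyclic order, picks up `b` and drops it at the next letter of the row `x`. -/
def IsArcBelow (x : Fin n → ℕ) (b : Fin n) (S : Fin n → Prop) : Prop :=
  ∀ k, S k ↔ k = b ∨ S (k + 1) ∧ x k = 0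

/-- The analogue of `IsArcBelow` for a carrier that visits the letters in increasing cyclic order;
here `S` consists of the letters at which the carrier arrives with `b` on board. -/
def IsArcAbove (x : Fin n → ℕ) (b : Fin n) (S : Fin n → Prop) : Prop :=
  ∀ k, S (k + 1) ↔ k = b ∨ S k ∧ x k = 0

theorem isArcBelow_of_below_nonempty (h : (below x b).Nonempty) :
    IsArcBelow x b fun k => (below x b).max' h < k ∧ k ≤ b := fun k => by
  have := max'_below_spec h
  have := @le_max'_below n x b k h
  have := val_add_one_eq k
  grind

theorem isArcBelow_of_below_empty (h : ¬ (below x b).Nonempty) (hx : (letters x).Nonempty) :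
    IsArcBelow x b fun k => k ≤ b ∨ (letters x).max' hx < k := fun k => by
  have := max'_letters_pos hx
  have := le_of_below_empty h (max'_letters_pos hx)
  have := @le_max'_letters n x k hx
  have := @le_of_below_empty n x b k h
  have := val_add_one_eq k
  grind

theorem isArcAbove_of_above_nonempty (h : (above x b).Nonempty) :
    IsArcAbove x b fun k => b < k ∧ k ≤ (above x b).min' h := fun k => by
  have := min'_above_spec h
  have := @min'_above_le n x b k h
  have := val_add_one_eq k
  grind

theorem isArcAbove_of_above_empty (h : ¬ (above x b).Nonempty) (hx : (letters x).Nonempty) :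
    IsArcAbove x b fun k => b < k ∨ k ≤ (letters x).min' hx := fun k => by
  have := min'_letters_pos hx
  have := le_of_above_empty h (min'_letters_pos hx)
  have := @min'_letters_le n x k hx
  have := @le_of_above_empty n x b k h
  have := val_add_one_eq k
  grind

theorem IsArcBelow.isColCarrier (hS : IsArcBelow x d.1.1 S) (hT : IsArcBelow x d.1.2 T) :
    IsColCarrier x d fun k => if S k ∨ T k then 1 else 0 where
  eq_max k := by
    rw [colCount_eq]
    have := hS k
    have := hT k
    have : d.Has k ↔ k = d.1.1 ∨ k = d.1.2 := Iff.rfl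
    grind
  le_one k := by split_ifs <;> omega

theorem IsArcAbove.isColCocarrier (hS : IsArcAbove x d.1.1 S) (hT : IsArcAbove x d.1.2 T) :
    IsColCocarrier x d fun k => if S k ∨ T k then 1 else 0 where
  eq_max k := by
    rw [colCount_eq]
    have := hS k
    have := hT k
    have : d.Has k ↔ k = d.1.1 ∨ k = d.1.2 := Iff.rfl
    grind
  le_one k := by split_ifs <;> omega

theorem exists_isColCarrier_of_below_nonempty (hβ : (below x d.1.1).Nonempty) :
    ∃ c, IsColCarrier x d c ∧
      ∀ k, (colCount (iotaColumn x d.1.1 d.1.2) k : ℤ) = colCount d.1 k + c (k + 1) - c k := by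
  have hp := max'_below_spec hβ
  have hγ : (below x d.1.2).Nonempty := by
    by_contra h
    exact not_lt.2 (le_of_below_empty h hp.1) (hp.2.trans d.2)
  have hq := max'_below_spec hγ
  have hpq := le_max'_below hγ hp.1 (hp.2.trans d.2)
  have hqβ := le_max'_below hβ hq.1
  refine ⟨_, (isArcBelow_of_below_nonempty hβ).isColCarrier (isArcBelow_of_below_nonempty hγ),
    fun k => ?_⟩
  rw [iotaColumn, dif_pos hβ, dif_pos hγ]
  have := val_add_one_eq k
  have := d.2
  split_ifs <;> grind [colCount]

theorem exists_isColCarrier_of_below_empty (hβ : ¬ (below x d.1.1).Nonempty)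
    (hx : (letters x).Nonempty) :
    ∃ c, IsColCarrier x d c ∧
      ∀ k, (colCount (iotaColumn x d.1.1 d.1.2) k : ℤ) = colCount d.1 k + c (k + 1) - c k := by
  have hl := max'_letters_pos hx
  have hβl := le_of_below_empty hβ hl
  have := d.2
  rw [iotaColumn, dif_neg hβ, dif_pos hx]
  by_cases hγ : (below x d.1.2).Nonempty
  · have hq := max'_below_spec hγ
    have hβq := le_of_below_empty hβ hq.1
    have hql := le_max'_letters hx hq.1
    have hlq := le_max'_below hγ hl
    refine ⟨_, (isArcBelow_of_below_empty hβ hx).isColCarrier (isArcBelow_of_below_nonempty hγ),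
      fun k => ?_⟩
    have := val_add_one_eq k
    split_ifs <;> grind [colCount]
  · have hγl := le_of_below_empty hγ hl
    refine ⟨_, (isArcBelow_of_below_empty hβ hx).isColCarrier (isArcBelow_of_below_empty hγ hx),
      fun k => ?_⟩
    rw [if_pos hγl, dif_neg hγ]
    have := val_add_one_eq k
    grind [colCount]

theorem exists_isColCocarrier_of_above_nonempty (hα : (above x d.1.1).Nonempty)
    (hx : (letters x).Nonempty) :
    ∃ c, IsColCocarrier x d c ∧
      ∀ k, (colCount (iotaInvColumn x d.1.1 d.1.2) k : ℤ) =
        colCount d.1 k + c k - c (k + 1) := by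
  have hp := min'_above_spec hα
  have hαβ := d.2
  rw [iotaInvColumn, dif_pos hx, dif_pos hα]
  by_cases hβ : (above x d.1.2).Nonempty
  · have hq := min'_above_spec hβ
    have hpq := min'_above_le hα hq.1 (hαβ.trans hq.2)
    have hqp := min'_above_le hβ hp.1
    refine ⟨_, (isArcAbove_of_above_nonempty hα).isColCocarrier
      (isArcAbove_of_above_nonempty hβ), fun k => ?_⟩
    rw [dif_pos hβ]
    have := val_add_one_eq k
    split_ifs <;> grind [colCount]
  · have hl := min'_letters_pos hx
    have hlp := min'_letters_le hx hp.1
    have hpl := min'_above_le hα hl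
    have hpβ := le_of_above_empty hβ hp.1
    refine ⟨_, (isArcAbove_of_above_nonempty hα).isColCocarrier
      (isArcAbove_of_above_empty hβ hx), fun k => ?_⟩
    rw [dif_neg hβ]
    have := val_add_one_eq k
    split_ifs <;> grind [colCount]

theorem exists_isColCocarrier_of_above_empty (hα : ¬ (above x d.1.1).Nonempty)
    (hx : (letters x).Nonempty) :
    ∃ c, IsColCocarrier x d c ∧
      ∀ k, (colCount (iotaInvColumn x d.1.1 d.1.2) k : ℤ) =
        colCount d.1 k + c k - c (k + 1) := by
  have hl := le_of_above_empty hα (min'_letters_pos hx)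
  have hβ : ¬ (above x d.1.2).Nonempty := fun h =>
    not_lt.2 (le_of_above_empty hα (min'_above_spec h).1) (d.2.trans (min'_above_spec h).2)
  refine ⟨_, (isArcAbove_of_above_empty hα hx).isColCocarrier (isArcAbove_of_above_empty hβ hx),
    fun k => ?_⟩
  rw [iotaInvColumn, dif_pos hx, dif_neg hα]
  have := val_add_one_eq k
  have := d.2
  grind [colCount]

end Arcs

section Iota

variable {n : ℕ} [NeZero n] {ℓ : ℕ} {x x' : Row n ℓ} {d d' : Domino n} {c : Fin n → ℤ}

theorem exists_isColCarrier_iota (hℓ : 1 ≤ ℓ) (x : Row n ℓ) (d : Domino n) :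
    ∃ c, IsColCarrier x.1 d c ∧
      Transports c x.1 (colCount d.1) (colCount (iota n ℓ (x, d)).1.1) (iota n ℓ (x, d)).2.1 := by
  obtain ⟨c, hc, hcol⟩ : ∃ c, IsColCarrier x.1 d c ∧ ∀ k,
      (colCount (iotaColumn x.1 d.1.1 d.1.2) k : ℤ) = colCount d.1 k + c (k + 1) - c k := by
    by_cases h : (below x.1 d.1.1).Nonempty
    · exact exists_isColCarrier_of_below_nonempty h
    · exact exists_isColCarrier_of_below_empty h (letters_nonempty hℓ x)
  refine ⟨c, hc, hcol, fun k => ?_⟩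
  have := hc.eq_max k
  have := hcol k
  have : (iota n ℓ (x, d)).2.1 k =
    x.1 k + colCount d.1 k - colCount (iotaColumn x.1 d.1.1 d.1.2) k := rfl
  omega

theorem exists_isColCocarrier_iotaInv (hℓ : 1 ≤ ℓ) (d : Domino n) (x : Row n ℓ) :
    ∃ c, IsColCocarrier x.1 d c ∧ Transports c (colCount d.1) x.1
      (iotaInv n ℓ (d, x)).1.1 (colCount (iotaInv n ℓ (d, x)).2.1) := by
  have hx := letters_nonempty hℓ x
  obtain ⟨c, hc, hcol⟩ : ∃ c, IsColCocarrier x.1 d c ∧ ∀ k,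
      (colCount (iotaInvColumn x.1 d.1.1 d.1.2) k : ℤ) = colCount d.1 k + c k - c (k + 1) := by
    by_cases h : (above x.1 d.1.1).Nonempty
    · exact exists_isColCocarrier_of_above_nonempty h hx
    · exact exists_isColCocarrier_of_above_empty h hx
  refine ⟨c, hc, fun k => ?_, hcol⟩
  have := hc.eq_max k
  have := hcol k
  have : (iotaInv n ℓ (d, x)).1.1 k =
    x.1 k + colCount d.1 k - colCount (iotaInvColumn x.1 d.1.1 d.1.2) k := rfl
  omega

theorem iota_eq_of_isColCarrier (hℓ : 1 ≤ ℓ) (hc : IsColCarrier x.1 d c)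
    (h : Transports c x.1 (colCount d.1) (colCount d'.1) x'.1) : iota n ℓ (x, d) = (d', x') := by
  obtain ⟨c', hc', h'⟩ := exists_isColCarrier_iota hℓ x d
  obtain rfl := hc.unique hc'
  exact Prod.ext (colCount_injective (h'.fst_unique h)) (Subtype.ext (h'.snd_unique h))

theorem iotaInv_eq_of_isColCocarrier (hℓ : 1 ≤ ℓ) (hc : IsColCocarrier x.1 d c)
    (h : Transports c (colCount d.1) x.1 x'.1 (colCount d'.1)) :
    iotaInv n ℓ (d, x) = (x', d') := by
  obtain ⟨c', hc', h'⟩ := exists_isColCocarrier_iotaInv hℓ d x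
  obtain rfl := hc.unique hc'
  exact Prod.ext (Subtype.ext (h'.fst_unique h)) (colCount_injective (h'.snd_unique h))

theorem iotaInv_iota (hℓ : 1 ≤ ℓ) (b : Row n ℓ × Domino n) : iotaInv n ℓ (iota n ℓ b) = b := by
  obtain ⟨c, hc, h⟩ := exists_isColCarrier_iota hℓ b.1 b.2
  exact iotaInv_eq_of_isColCocarrier hℓ (hc.isColCocarrier h) h.symm

theorem iota_iotaInv (hℓ : 1 ≤ ℓ) (b : Domino n × Row n ℓ) : iota n ℓ (iotaInv n ℓ b) = b := by
  obtain ⟨c, hc, h⟩ := exists_isColCocarrier_iotaInv hℓ b.1 b.2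
  exact iota_eq_of_isColCarrier hℓ (hc.isColCarrier h) h.symm

theorem iota_f (hℓ : 1 ≤ ℓ) (i : Fin (n - 1)) {b b' : Row n ℓ × Domino n}
    (hb : ((rowCrystal n ℓ).tensor (dominoCrystal n)).f i b = some b') :
    ((dominoCrystal n).tensor (rowCrystal n ℓ)).f i (iota n ℓ b) = some (iota n ℓ b') := by
  obtain ⟨s, t, hx, hd, hst⟩ := ((rowCrystal_isContentDetermined n ℓ).tensor_f_eq_some_iff
    (dominoCrystal_isContentDetermined n)).1 hb
  obtain ⟨c, hc, h⟩ := exists_isColCarrier_iota hℓ b.1 b.2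
  obtain ⟨c', hc', h'⟩ := exists_isColCarrier_iota hℓ b'.1 b'.2
  obtain ⟨u, hu, hst'⟩ := hc.exists_update h hx hd hst
  obtain rfl := hu.unique hc'
  obtain ⟨hd', hx'⟩ := h.isShift hx hd h'
  exact ((dominoCrystal_isContentDetermined n).tensor_f_eq_some_iff
    (rowCrystal_isContentDetermined n ℓ)).2 ⟨t - u, s + u, hd', hx', hst'⟩

theorem iota_phi (hℓ : 1 ≤ ℓ) (i : Fin (n - 1)) (b : Row n ℓ × Domino n) :
    ((dominoCrystal n).tensor (rowCrystal n ℓ)).phi i (iota n ℓ b) =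
      ((rowCrystal n ℓ).tensor (dominoCrystal n)).phi i b := by
  obtain ⟨x, d⟩ := b
  obtain ⟨c, hc, h⟩ := exists_isColCarrier_iota hℓ x d
  have := lo_add_one i ▸ hc.eq_max (lo i)
  have := hc.eq_max (hi i)
  have := lo_add_one i ▸ h.apply_fst (lo i)
  have := lo_add_one i ▸ h.apply_snd (lo i)
  have := h.apply_fst (hi i)
  have := h.apply_snd (hi i)
  have := hc.nonneg (hi i + 1)
  have := hc.le_one (hi i + 1)
  have := colCount_le_one d (lo i)
  have := colCount_le_one d (hi i)
  have := dominoCrystal_phi i d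
  have := dominoCrystal_eps i d
  have := dominoCrystal_phi i (iota n ℓ (x, d)).1
  simp only [Crystal.tensor, rowCrystal]
  grind

theorem iota_isMorphism (hℓ : 1 ≤ ℓ) :
    IsMorphism ((rowCrystal n ℓ).tensor (dominoCrystal n))
      ((dominoCrystal n).tensor (rowCrystal n ℓ)) (iota n ℓ) :=
  ((rowCrystal_isNormal n ℓ).tensor (dominoCrystal_isNormal n)).isMorphism
    ((dominoCrystal_isNormal n).tensor (rowCrystal_isNormal n ℓ))
    (fun b => by
      obtain ⟨c, -, h⟩ := exists_isColCarrier_iota hℓ b.1 b.2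
      exact funext h.add_eq)
    (iota_phi hℓ) fun i _ _ => iota_f hℓ i

end Iota

section ThreefoldTensorProducts

variable {n : ℕ} {s t u : Shape}

/-- The number of letters `k` in an element of one of the crystals `B_ℓ` and `B_♮`. -/
def Shape.content : (s : Shape) → (s.crystal n).carrier → Fin n → ℕ
  | .row _ => Subtype.val
  | .col => fun d => colCount d.1

/-- The number of letters `k` in an element of a threefold tensor product. -/
def tripleContent (b : Triple n s t u) (k : Fin n) : ℕ :=
  s.content b.1 k + (t.content b.2.1 k + u.content b.2.2 k)

/-- The shape is not the empty row, on which `ι''` and its inverse exchange no letters. -/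
def Shape.IsPos : Shape → Prop
  | .row ℓ => 1 ≤ ℓ
  | .col => True

theorem Shape.crystal_isNormal : (s : Shape) → (s.crystal n).IsNormal s.content
  | .row ℓ => rowCrystal_isNormal n ℓ
  | .col => dominoCrystal_isNormal n

variable [NeZero n]

theorem sigma_sigma (hs : s.IsPos) (ht : t.IsPos)
    (b : ((s.crystal n).tensor (t.crystal n)).carrier) : sigma n t s (sigma n s t b) = b := by
  match s, t with
  | .row ℓ, .row m => exact R_R ℓ m b
  | .row ℓ, .col => exact iotaInv_iota hs b
  | .col, .row m => exact iota_iotaInv ht b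
  | .col, .col => rfl

theorem sigma_isMorphism (hs : s.IsPos) (ht : t.IsPos) :
    IsMorphism ((s.crystal n).tensor (t.crystal n)) ((t.crystal n).tensor (s.crystal n))
      (sigma n s t) := by
  match s, t with
  | .row ℓ, .row m => exact R_isMorphism ℓ m
  | .row ℓ, .col => exact iota_isMorphism hs
  | .col, .row m => exact (iota_isMorphism ht).inverse (iotaInv_iota ht) (iota_iotaInv ht)
  | .col, .col => exact isMorphism_id _

theorem sigma_content (hs : s.IsPos) (ht : t.IsPos)
    (b : ((s.crystal n).tensor (t.crystal n)).carrier) (k : Fin n) :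
    t.content (sigma n s t b).1 k + s.content (sigma n s t b).2 k =
      s.content b.1 k + t.content b.2 k := by
  match s, t with
  | .row ℓ, .row m => exact (R_transports b).add_eq k
  | .row ℓ, .col =>
    obtain ⟨_, -, h⟩ := exists_isColCarrier_iota hs b.1 b.2
    exact h.add_eq k
  | .col, .row m =>
    obtain ⟨_, -, h⟩ := exists_isColCocarrier_iotaInv ht b.1 b.2
    exact h.add_eq k
  | .col, .col => rfl

theorem sigma₁_sigma₁ (hs : s.IsPos) (ht : t.IsPos) (b : Triple n s t u) :
    sigma₁ (sigma₁ b) = b :=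
  congrArg (fun p : (s.crystal n).carrier × (t.crystal n).carrier => (p.1, p.2, b.2.2))
    (sigma_sigma hs ht (b.1, b.2.1))

theorem sigma₂_sigma₂ (ht : t.IsPos) (hu : u.IsPos) (b : Triple n s t u) :
    sigma₂ (sigma₂ b) = b :=
  Prod.ext rfl (sigma_sigma ht hu b.2)

theorem sigma₁_injective (hs : s.IsPos) (ht : t.IsPos) :
    Function.Injective (sigma₁ : Triple n s t u → Triple n t s u) :=
  Function.LeftInverse.injective (g := sigma₁) (sigma₁_sigma₁ hs ht)

theorem sigma₂_injective (ht : t.IsPos) (hu : u.IsPos) :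
    Function.Injective (sigma₂ : Triple n s t u → Triple n s u t) :=
  Function.LeftInverse.injective (g := sigma₂) (sigma₂_sigma₂ ht hu)

theorem sigma₁_isMorphism (hs : s.IsPos) (ht : t.IsPos) :
    IsMorphism ((s.crystal n).tensor ((t.crystal n).tensor (u.crystal n)))
      ((t.crystal n).tensor ((s.crystal n).tensor (u.crystal n))) sigma₁ :=
  (sigma_isMorphism hs ht).tensor_left _

theorem sigma₂_isMorphism (ht : t.IsPos) (hu : u.IsPos) :
    IsMorphism ((s.crystal n).tensor ((t.crystal n).tensor (u.crystal n)))
      ((s.crystal n).tensor ((u.crystal n).tensor (t.crystal n))) sigma₂ :=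
  (sigma_isMorphism ht hu).id_tensor _

theorem tripleContent_sigma₁ (hs : s.IsPos) (ht : t.IsPos) (b : Triple n s t u) :
    tripleContent (sigma₁ b) = tripleContent b := by
  funext k
  simp only [tripleContent, ← add_assoc]
  exact congrArg (· + _) (sigma_content hs ht (b.1, b.2.1) k)

theorem tripleContent_sigma₂ (ht : t.IsPos) (hu : u.IsPos) (b : Triple n s t u) :
    tripleContent (sigma₂ b) = tripleContent b :=
  funext fun k => congrArg (_ + ·) (sigma_content ht hu b.2 k)

/-- The braid relation at a single element of `B_s ⊗ B_t ⊗ B_u`. -/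
def BraidsAt (b : Triple n s t u) : Prop :=
  sigma₁ (sigma₂ (sigma₁ b)) = sigma₂ (sigma₁ (sigma₂ b))

theorem BraidsAt.of_sigma_eq {b₁ c₁ c₁' d₁ : (s.crystal n).carrier}
    {b₂ c₂ c₂' d₂ : (t.crystal n).carrier} {b₃ c₃ c₃' d₃ : (u.crystal n).carrier}
    (h₁₂ : sigma n s t (b₁, b₂) = (c₂, c₁)) (h₁₃ : sigma n s u (c₁, b₃) = (c₃, d₁))
    (h₂₃ : sigma n t u (c₂, c₃) = (d₃, d₂)) (h₂₃' : sigma n t u (b₂, b₃) = (c₃', c₂'))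
    (h₁₃' : sigma n s u (b₁, c₃') = (d₃, c₁')) (h₁₂' : sigma n s t (c₁', c₂') = (d₂, d₁)) :
    BraidsAt (b₁, b₂, b₃) := by
  simp only [BraidsAt, sigma₁, sigma₂, *]
  rfl

theorem braidsAt_iff (hs : s.IsPos) (ht : t.IsPos) (hu : u.IsPos) (b : Triple n s t u) :
    BraidsAt b ↔ sigma₂ (sigma₁ (sigma₂ (sigma₁ (sigma₂ (sigma₁ b))))) = b := by
  constructor
  · intro h
    rw [h, sigma₂_sigma₂ hs ht, sigma₁_sigma₁ hs hu, sigma₂_sigma₂ ht hu]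
  · intro h
    have h₂ := congrArg (fun b => sigma₂ (sigma₁ (sigma₂ b))) h
    simp only [sigma₂_sigma₂ hu ht, sigma₁_sigma₁ hu hs, sigma₂_sigma₂ ht hs] at h₂
    exact h₂

theorem braidRelation_of_isHighest (hs : s.IsPos) (ht : t.IsPos) (hu : u.IsPos)
    (h : ∀ b c : Triple n s t u,
      ((s.crystal n).tensor ((t.crystal n).tensor (u.crystal n))).IsHighest b →
      ((s.crystal n).tensor ((t.crystal n).tensor (u.crystal n))).IsHighest c →
      tripleContent b = tripleContent c → b = c ∨ BraidsAt b ∨ BraidsAt c) :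
    BraidRelation n s t u := by
  have normal : ((s.crystal n).tensor ((t.crystal n).tensor (u.crystal n))).IsNormal
      tripleContent :=
    s.crystal_isNormal.tensor (t.crystal_isNormal.tensor u.crystal_isNormal)
  have eq_id := normal.eq_id
    ((sigma₂_isMorphism hu ht).comp <| (sigma₁_isMorphism hu hs).comp <|
      (sigma₂_isMorphism ht hs).comp <| (sigma₁_isMorphism ht hu).comp <|
      (sigma₂_isMorphism hs hu).comp <| sigma₁_isMorphism hs ht) ?_ ?_ ?_
  · exact fun b => (braidsAt_iff hs ht hu b).2 (congrFun eq_id b)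
  · exact (sigma₂_injective hu ht).comp <| (sigma₁_injective hu hs).comp <|
      (sigma₂_injective ht hs).comp <| (sigma₁_injective ht hu).comp <|
      (sigma₂_injective hs hu).comp <| sigma₁_injective hs ht
  · intro b
    simp only [Function.comp_apply, tripleContent_sigma₁, tripleContent_sigma₂, hs, ht, hu]
  · simpa only [Function.comp_apply, ← braidsAt_iff hs ht hu] using h

theorem BraidRelation.swap_right (ht : t.IsPos) (hu : u.IsPos) (h : BraidRelation n s t u) :
    BraidRelation n s u t := by
  intro b
  have hb := congrArg sigma₁ (h (sigma₂ b))
  rw [sigma₂_sigma₂ hu ht, sigma₁_sigma₁ ht hu] at hb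
  exact hb.symm

theorem BraidRelation.swap_left (hs : s.IsPos) (ht : t.IsPos) (h : BraidRelation n s t u) :
    BraidRelation n t s u := by
  intro b
  have hb := congrArg sigma₂ (h (sigma₁ b))
  rw [sigma₁_sigma₁ ht hs, sigma₂_sigma₂ hs ht] at hb
  exact hb.symm

end ThreefoldTensorProducts

section RowRowColumn

variable {n ℓ m : ℕ} {a : Fin n} {x : Row n ℓ} {y : Row n m} {d : Domino n}

theorem Row.ext_of_ne {y z : Row n m} (h : ∀ k ≠ a, y.1 k = z.1 k) : y = z := by
  have hsum : ∑ k, y.1 k = ∑ k, z.1 k := y.2.trans z.2.symm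
  rw [Fintype.sum_eq_add_sum_compl a, Fintype.sum_eq_add_sum_compl a,
    Finset.sum_congr rfl fun k hk => h k (by simpa using hk)] at hsum
  refine Subtype.ext (funext fun k => ?_)
  by_cases hk : k = a
  · exact hk ▸ Nat.add_right_cancel hsum
  · exact h k hk

theorem Row.apply_eq_length (hx : ∀ k ≠ a, x.1 k = 0) : x.1 a = ℓ :=
  (Fintype.sum_eq_single a hx).symm.trans x.2

theorem isHighest_row_row_col
    (hb : ((rowCrystal n ℓ).tensor ((rowCrystal n m).tensor (dominoCrystal n))).IsHighest
      (x, y, d)) {j k : Fin n} (hjk : j.1 + 1 = k.1) :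
    x.1 k = 0 ∧ y.1 k ≤ x.1 j ∧ y.1 k + colCount d.1 k ≤ x.1 j + y.1 j + colCount d.1 j := by
  obtain ⟨hx, hyd⟩ := Crystal.isHighest_tensor_iff.1 hb
  let i : Fin (n - 1) := ⟨j.1, by omega⟩
  have hi_eq : hi i = k := Fin.ext hjk
  have := hyd i
  simp only [Crystal.tensor, rowCrystal, dominoCrystal_eps i d] at this
  rw [← hi_eq, show j = lo i from rfl]
  exact ⟨hx i, by omega⟩

theorem fst_apply_eq_zero_of_isHighest
    (hb : ((rowCrystal n ℓ).tensor ((rowCrystal n m).tensor (dominoCrystal n))).IsHighest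
      (x, y, d)) {k : Fin n} (hk : 1 ≤ k.1) :
    x.1 k = 0 :=
  (isHighest_row_row_col hb (j := ⟨k.1 - 1, by omega⟩) (k := k) (by dsimp only; omega)).1

theorem snd_apply_eq_zero_of_isHighest
    (hb : ((rowCrystal n ℓ).tensor ((rowCrystal n m).tensor (dominoCrystal n))).IsHighest
      (x, y, d)) {k : Fin n} (hk : 2 ≤ k.1) :
    y.1 k = 0 := by
  have := isHighest_row_row_col hb (j := ⟨k.1 - 1, by omega⟩) (k := k) (by dsimp only; omega)
  have := fst_apply_eq_zero_of_isHighest hb (k := ⟨k.1 - 1, by omega⟩) (by dsimp only; omega)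
  omega

theorem col_eq_of_isHighest_row_row_col
    (hb : ((rowCrystal n ℓ).tensor ((rowCrystal n m).tensor (dominoCrystal n))).IsHighest
      (x, y, d)) :
    d.1.1.1 = 0 ∧ d.1.2.1 = 1 ∨ d.1.1.1 = 0 ∧ d.1.2.1 = 2 ∨ d.1.1.1 = 1 ∧ d.1.2.1 = 2 ∨
      d.1.1.1 = 2 ∧ d.1.2.1 = 3 := by
  have : d.1.1.1 < d.1.2.1 := d.2
  have has_pred {k : Fin n} (hk : d.Has k) (three_le : 3 ≤ k.1) :
      k.1 = d.1.1.1 + 1 ∨ k.1 = d.1.2.1 + 1 := by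
    let j : Fin n := ⟨k.1 - 1, by omega⟩
    have := isHighest_row_row_col hb (j := j) (k := k) (by dsimp only [j]; omega)
    have := fst_apply_eq_zero_of_isHighest hb (k := j) (by dsimp only [j]; omega)
    have := snd_apply_eq_zero_of_isHighest hb (k := j) (by dsimp only [j]; omega)
    have hj : d.Has j := by
      rw [← colCount_eq_one_iff] at hk ⊢
      have := colCount_le_one d j
      omega
    simp only [Domino.Has, Fin.ext_iff, j] at hj
    omega
  have := has_pred (.inl rfl)
  have := has_pred (.inr rfl)
  omega

theorem col_eq_or_of_isHighest {y' : Row n m} {d' : Domino n}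
    (hb : ((rowCrystal n ℓ).tensor ((rowCrystal n m).tensor (dominoCrystal n))).IsHighest
      (x, y, d))
    (hb' : ((rowCrystal n ℓ).tensor ((rowCrystal n m).tensor (dominoCrystal n))).IsHighest
      (x, y', d'))
    (hyd : ∀ k, y.1 k + colCount d.1 k = y'.1 k + colCount d'.1 k) :
    d = d' ∨ (d.1.1.1 = 1 ∧ d.1.2.1 = 2) ∧ d'.1.1.1 = 0 ∧ d'.1.2.1 = 2 ∨
      (d.1.1.1 = 0 ∧ d.1.2.1 = 2) ∧ d'.1.1.1 = 1 ∧ d'.1.2.1 = 2 := by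
  have has_iff (k : Fin n) (hk : 2 ≤ k.1) : d.Has k ↔ d'.Has k := by
    have := hyd k
    rw [snd_apply_eq_zero_of_isHighest hb hk, snd_apply_eq_zero_of_isHighest hb' hk, zero_add,
      zero_add] at this
    rw [← colCount_eq_one_iff, this, colCount_eq_one_iff]
  have := col_eq_of_isHighest_row_row_col hb
  have := col_eq_of_isHighest_row_row_col hb'
  have := has_iff d.1.1
  have := has_iff d.1.2
  have := has_iff d'.1.1
  have := has_iff d'.1.2
  simp only [Domino.Has, Subtype.ext_iff, Prod.ext_iff, Fin.ext_iff, true_or, or_true, true_iff,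
    iff_true] at *
  omega

variable [NeZero n]

theorem R_fst_apply_eq_zero (hmℓ : m ≤ ℓ) {k : Fin n} (hk : x.1 k = 0) :
    (R n ℓ m (x, y)).1.1 k = 0 := by
  have hP : IsRowCarrier x.1 y.1 (P x.1 y.1) := isRowCarrier_P (by rwa [x.2, y.2])
  have := hP k
  have := hP (k + 1)
  have := (R_transports (x, y)).apply_fst k
  dsimp only at this
  omega

theorem R_eq_of_eq_zero {x' : Row n m} {y' : Row n ℓ} (hx : ∀ k ≠ a, x.1 k = 0)
    (hx' : ∀ k ≠ a, x'.1 k = 0) (hy : ∀ k ≠ a, y'.1 k = y.1 k) :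
    R n ℓ m (x, y) = (x', y') := by
  wlog hmℓ : m ≤ ℓ generalizing ℓ m x y x' y'
  · rw [← this hx' hx (fun k hk => (hy k hk).symm) (le_of_not_ge hmℓ), R_R]
  have fst_eq_zero (k : Fin n) (hk : k ≠ a) : (R n ℓ m (x, y)).1.1 k = 0 :=
    R_fst_apply_eq_zero hmℓ (hx k hk)
  refine Prod.ext (Row.ext_of_ne fun k hk => (fst_eq_zero k hk).trans (hx' k hk).symm)
    (Row.ext_of_ne (a := a) fun k hk => ?_)
  have := (R_transports (x, y)).add_eq k
  rwa [fst_eq_zero k hk, hx k hk, zero_add, zero_add, ← hy k hk] at this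

theorem exists_R_eq (hx : ∀ k ≠ a, x.1 k = 0) (hm : m ≤ ℓ + y.1 a) :
    ∃ (x' : Row n m) (y' : Row n ℓ), R n ℓ m (x, y) = (x', y') ∧
      (∀ k ≠ a, x'.1 k = 0) ∧ ∀ k ≠ a, y'.1 k = y.1 k := by
  let x' : Row n m := ⟨Pi.single a m, Fintype.sum_pi_single' a m⟩
  let y' : Row n ℓ := ⟨Function.update y.1 a (ℓ + y.1 a - m), by
    have := y.2
    rw [Fintype.sum_eq_add_sum_compl a] at this
    rw [Finset.sum_update_of_mem (Finset.mem_univ a), ← Finset.compl_eq_univ_sdiff]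
    omega⟩
  have hx' (k : Fin n) (hk : k ≠ a) : x'.1 k = 0 :=
    Pi.single_eq_of_ne (i := a) (M := fun _ => ℕ) hk m
  have hy' (k : Fin n) (hk : k ≠ a) : y'.1 k = y.1 k := Function.update_of_ne hk _ _
  exact ⟨x', y', R_eq_of_eq_zero hx hx' hy', hx', hy'⟩

theorem isColCarrier_colCount (h : ∀ k, d.Has (k + 1) → ¬ d.Has k → 0 < y.1 k) :
    IsColCarrier y.1 d (fun k => colCount d.1 k) where
  eq_max k := by
    have := h k
    rw [← colCount_eq_one_iff, ← colCount_eq_zero_iff] at this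
    have := colCount_le_one d (k + 1)
    omega
  le_one k := by exact_mod_cast colCount_le_one d k

theorem exists_iota_eq (hm : 1 ≤ m) (h : ∀ k, d.Has (k + 1) → ¬ d.Has k → 0 < y.1 k) :
    ∃ e z, iota n m (y, d) = (e, z) ∧ (∀ k, colCount e.1 k = colCount d.1 (k + 1)) ∧
      ∀ k, colCount e.1 k + z.1 k = y.1 k + colCount d.1 k := by
  obtain ⟨c, hc, ht⟩ := exists_isColCarrier_iota hm y d
  obtain rfl := hc.unique (isColCarrier_colCount h)
  rcases hι : iota n m (y, d) with ⟨e, z⟩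
  rw [hι] at ht
  refine ⟨e, z, rfl, fun k => ?_, ht.add_eq⟩
  have := ht.apply_fst k
  dsimp only at this
  omega

theorem iota_eq_swap (hℓ : 1 ≤ ℓ) (h : ∀ k, ¬ d.Has k → x.1 k = 0) :
    iota n ℓ (x, d) = (d, x) :=
  iota_eq_of_isColCarrier (c := 1) hℓ
    { eq_max := fun k => by
        have := h k
        rw [← colCount_eq_zero_iff] at this
        have := colCount_le_one d k
        simp only [Pi.one_apply]
        omega
      le_one := fun _ => le_rfl }
    { apply_fst := fun _ => by simp only [Pi.one_apply, add_sub_cancel_right]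
      apply_snd := fun _ => by simp only [Pi.one_apply, add_sub_cancel_right] }

theorem braidsAt_row_row_col (hℓ : 1 ≤ ℓ) (hm : 1 ≤ m) (hx : ∀ k ≠ a, x.1 k = 0)
    (hya : 0 < y.1 a) (hlt : m < ℓ + y.1 a) (had : d.Has (a + 1))
    (hd : ∀ k, d.Has (k + 1) → d.Has k ∨ k = a) :
    BraidsAt (s := .row ℓ) (t := .row m) (u := .col) (x, y, d) := by
  obtain ⟨x', y', hR, hx', hy'⟩ := exists_R_eq hx hlt.le
  have hy'a : 0 < y'.1 a := by
    have := (R_transports (x, y)).add_eq a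
    rw [hR] at this
    dsimp only at this
    rw [Row.apply_eq_length hx, Row.apply_eq_length hx'] at this
    omega
  have rotate {q : ℕ} {w : Row n q} (hw : 0 < w.1 a) (k : Fin n) (hk : d.Has (k + 1))
      (hk' : ¬ d.Has k) : 0 < w.1 k :=
    (hd k hk).resolve_left hk' ▸ hw
  obtain ⟨e, z, hι, he, hz⟩ := exists_iota_eq hm (rotate hya)
  obtain ⟨e', z', hι', he', hz'⟩ := exists_iota_eq hℓ (rotate hy'a)
  obtain rfl : e = e' := colCount_injective (funext fun k => (he k).trans (he' k).symm)
  have hea : e.Has a := by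
    rw [← colCount_eq_one_iff] at had ⊢
    exact (he a).trans had
  have swap {q : ℕ} (hq : 1 ≤ q) {w : Row n q} (hw : ∀ k ≠ a, w.1 k = 0) :
      iota n q (w, e) = (e, w) :=
    iota_eq_swap hq fun k hk => hw k fun h => hk (h ▸ hea)
  have hRz : R n ℓ m (x, z) = (x', z') := R_eq_of_eq_zero hx hx' fun k hk => by
    have := hz k
    have := hz' k
    have := hy' k hk
    omega
  exact .of_sigma_eq hR hι' (swap hm hx') hι (swap hℓ hx) hRz

theorem braidsAt_of_col_eq {y' : Row n m} {d' : Domino n} (hℓ : 1 ≤ ℓ) (hm : 1 ≤ m)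
    (hb' : ((rowCrystal n ℓ).tensor ((rowCrystal n m).tensor (dominoCrystal n))).IsHighest
      (x, y', d')) (hyd : ∀ k, y.1 k + colCount d.1 k = y'.1 k + colCount d'.1 k)
    (hd : d.1.1.1 = 1 ∧ d.1.2.1 = 2) (hd' : d'.1.1.1 = 0 ∧ d'.1.2.1 = 2) :
    BraidsAt (s := .row ℓ) (t := .row m) (u := .col) (x, y, d) := by
  have val_eq_zero {k : Fin n} : k = 0 ↔ k.1 = 0 := by rw [Fin.ext_iff, Fin.val_zero]
  have hx (k : Fin n) (hk : k ≠ 0) : x.1 k = 0 :=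
    fst_apply_eq_zero_of_isHighest hb' (by have := val_eq_zero.not.1 hk; omega)
  have hy_zero : y.1 0 = y'.1 0 + 1 := by
    have h := hyd 0
    rwa [colCount_eq_zero_iff.2, colCount_eq_one_iff.2] at h
    · exact .inl (val_eq_zero.2 hd'.1).symm
    · simp only [Domino.Has, Fin.ext_iff, Fin.val_zero]
      omega
  have hm_eq : m = y'.1 0 + y'.1 d.1.1 := by
    have ne : 0 ≠ d.1.1 := fun h => by rw [← h, Fin.val_zero] at hd; omega
    rw [← Fintype.sum_eq_add (f := y'.1) 0 d.1.1 ne, y'.2]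
    refine fun k hk => snd_apply_eq_zero_of_isHighest hb' ?_
    simp only [ne_eq, Fin.ext_iff, Fin.val_zero] at hk
    omega
  have hy'_one : y'.1 d.1.1 ≤ ℓ :=
    Row.apply_eq_length hx ▸ (isHighest_row_row_col hb' (by rw [Fin.val_zero, hd.1])).2.1
  refine braidsAt_row_row_col (a := 0) hℓ hm hx (by omega) (by omega) ?_ fun k hk => ?_
  · have := val_add_one_eq (0 : Fin n)
    simp only [Domino.Has, Fin.ext_iff, Fin.val_zero] at this ⊢
    omega
  · have := val_add_one_eq k
    simp only [Domino.Has, Fin.ext_iff, Fin.val_zero] at hk ⊢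
    omega

theorem braidRelation_row_row_col (hℓ : 1 ≤ ℓ) (hm : 1 ≤ m) :
    BraidRelation n (.row ℓ) (.row m) .col := by
  refine braidRelation_of_isHighest hℓ hm trivial ?_
  rintro ⟨x, y, d⟩ ⟨x', y', d'⟩ hb hb' content_eq
  obtain rfl : x = x' := Row.ext_of_ne (a := 0) fun k hk => by
    have : 1 ≤ k.1 := Nat.pos_of_ne_zero (Fin.val_ne_zero_iff.2 hk)
    rw [fst_apply_eq_zero_of_isHighest hb this, fst_apply_eq_zero_of_isHighest hb' this]
  have hyd (k : Fin n) : y.1 k + colCount d.1 k = y'.1 k + colCount d'.1 k :=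
    Nat.add_left_cancel (congrFun content_eq k)
  rcases col_eq_or_of_isHighest hb hb' hyd with rfl | ⟨hd, hd'⟩ | ⟨hd, hd'⟩
  · obtain rfl : y = y' := Subtype.ext (funext fun k => Nat.add_right_cancel (hyd k))
    exact .inl rfl
  · exact .inr (.inl (braidsAt_of_col_eq hℓ hm hb' hyd hd hd'))
  · exact .inr (.inr (braidsAt_of_col_eq hℓ hm hb (fun k => (hyd k).symm) hd' hd))

end RowRowColumn

end ColouredBBS

theorem mainTheorem5 (n : ℕ) [NeZero n] (hn : 2 ≤ n) (ℓ₁ ℓ₂ : ℕ) (hℓ₁ : 1 ≤ ℓ₁) (hℓ₂ : 1 ≤ ℓ₂) :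
    (ColouredBBS.IsCrystalIso
        ((ColouredBBS.rowCrystal n ℓ₁).tensor (ColouredBBS.rowCrystal n ℓ₂))
        ((ColouredBBS.rowCrystal n ℓ₂).tensor (ColouredBBS.rowCrystal n ℓ₁))
        (ColouredBBS.R n ℓ₁ ℓ₂)) ∧
    (ColouredBBS.IsCrystalIso
        ((ColouredBBS.rowCrystal n ℓ₁).tensor (ColouredBBS.dominoCrystal n))
        ((ColouredBBS.dominoCrystal n).tensor (ColouredBBS.rowCrystal n ℓ₁))
        (ColouredBBS.iota n ℓ₁)) ∧
    (Function.LeftInverse (ColouredBBS.iotaInv n ℓ₁) (ColouredBBS.iota n ℓ₁) ∧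
      Function.RightInverse (ColouredBBS.iotaInv n ℓ₁) (ColouredBBS.iota n ℓ₁)) ∧
    (ColouredBBS.BraidRelation n (.row ℓ₁) (.row ℓ₂) .col ∧
      ColouredBBS.BraidRelation n (.row ℓ₁) .col (.row ℓ₂) ∧
      ColouredBBS.BraidRelation n .col (.row ℓ₁) (.row ℓ₂)) := by
  have hiota := ColouredBBS.iotaInv_iota (n := n) hℓ₁
  have hiotaInv := ColouredBBS.iota_iotaInv (n := n) hℓ₁
  have row_pos {ℓ : ℕ} (hℓ : 1 ≤ ℓ) : (ColouredBBS.Shape.row ℓ).IsPos := hℓ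
  have col_pos : ColouredBBS.Shape.col.IsPos := trivial
  have row_row_col := ColouredBBS.braidRelation_row_row_col (n := n) hℓ₁ hℓ₂
  have row_col_row := row_row_col.swap_right (row_pos hℓ₂) col_pos
  have col_row_row := row_col_row.swap_left (row_pos hℓ₁) col_pos
  exact ⟨⟨Function.bijective_iff_has_inverse.2 ⟨_, ColouredBBS.R_R ℓ₁ ℓ₂, ColouredBBS.R_R ℓ₂ ℓ₁⟩,
      (ColouredBBS.R_isMorphism ℓ₁ ℓ₂).f⟩,
    ⟨Function.bijective_iff_has_inverse.2 ⟨_, hiota, hiotaInv⟩,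
      (ColouredBBS.iota_isMorphism hℓ₁).f⟩,
    ⟨hiota, hiotaInv⟩, row_row_col, row_col_row, col_row_row⟩
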